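/- Let $p>3$ be a prime, let $N\ge 1$, and let $F$ be a field of characteristic $p$. Let $\Gamma_0(N)$ be the group of matrices in $SL_2(\mathbb Z)$ whose first row is congruent to $(*,0)$ modulo $N$, and let $\Delta$ be the semigroup of integral matrices in $GL_2(\mathbb Q)$ whose first row is congruent to $(*,0)$ modulo $N$ and whose determinant is positive and prime to $pN$. Every $\overline{\mathbb F}_p[GL_2(F)]$-module $V$ is regarded as a $\Delta$-module, hence as a $\Gamma_0(N)$-module, through reduction modulo $p$. For $s\in\Delta$ write $\Gamma_0(N)s\Gamma_0(N)=\coprod_{i} s_i\Gamma_0(N)$ (a finite disjoint union) and let $\deg(s)$ be the number of cosets $s_i\Gamma_0(N)$. The Hecke operator $T_s$ on $H^1(\Gamma_0(N),V)$ is induced by $(T_sz)(\gamma)=\sum_i s_i\, z(s_i^{-1}\gamma s_{j})$ on $1$-cocycles $z$, where $j=j(\gamma,i)$ is the index with $\gamma s_j\in s_i\Gamma_0(N)$. An eigenclass is a nonzero class $\alpha$ such that for every $s\in\Delta$ there is $a(s)\in\overline{\mathbb F}_p$ with $T_s\alpha=a(s)\alpha$; the function $a$ is its system of eigenvalues. An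 eigenclass is punctual if $a(s)=\deg(s)$ in $\overline{\mathbb F}_p$ for all $s$, and it is a twist of a punctual eigenclass if, for some $j\in\mathbb Z$, $a(s)=\det(s)^j\deg(s)$ in $\overline{\mathbb F}_p$ for all $s$. Lemma 3.9. Let $B$ be an $\overline{\mathbb F}_p[GL_2(F)]$-module and let $A$ be a subquotient of $B$, that is, $A\cong S/T$ for $GL_2(F)$-submodules $T\subset S\subset B$. If $\alpha$ is an eigenclass in $H^1(\Gamma_0(N),A)$ which is not a twist of a punctual eigenclass, then there is an eigenclass $\beta$ in $H^1(\Gamma_0(N),B)$ with the same system of eigenvalues as $\alpha$. -/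

import Mathlib

open scoped MatrixGroups Pointwise

universe u

noncomputable section

/-! ## Hecke operators on the first cohomology of a Hecke pair -/

namespace HeckeH1

section Cosets

variable {G : Type u} [Group G] (Δ : Submonoid G) (Γ : Subgroup G)

/-- The set `Γ s Γ / Γ` of left cosets `s' Γ` contained in the double coset `Γ s Γ`, described as
the orbit of the coset `s Γ` under left multiplication by `Γ`. -/
abbrev cosets (s : G) : Set (G ⧸ Γ) := MulAction.orbit Γ (s : G ⧸ Γ)

/-- The degree of the double coset `Γ s Γ`: the number of left cosets of `Γ` in it. -/
def degree (s : G) : ℕ := Nat.card (cosets Γ s)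

variable [hΓ : IsHeckeTriple Δ Γ Γ]

theorem finite_cosets (s : Δ) : Finite (cosets Γ (s : G)) := by
  have h1 : (MulAction.stabilizer Γ ((s : G) : G ⧸ Γ)).index ≠ 0 := by
    have h2 : (ConjAct.toConjAct (s : G) • Γ).relIndex Γ ≠ 0 :=
      (IsHeckeTriple.mem_commensurator_right (H₂ := Γ) Γ s).1
    have h3 : MulAction.stabilizer Γ ((s : G) : G ⧸ Γ)
        = (ConjAct.toConjAct (s : G) • Γ).subgroupOf Γ := by
      ext γ
      rw [MulAction.mem_stabilizer_iff, Subgroup.mem_subgroupOf,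
        Subgroup.mem_pointwise_smul_iff_inv_smul_mem, ← ConjAct.toConjAct_inv,
        ConjAct.toConjAct_smul, eq_comm]
      change ((s : G) : G ⧸ Γ) = (((γ : G) * (s : G) : G) : G ⧸ Γ) ↔ _
      rw [QuotientGroup.eq]
      simp [mul_assoc]
    rw [h3]
    exact h2
  have h4 : (MulAction.stabilizer Γ ((s : G) : G ⧸ Γ)).FiniteIndex := ⟨h1⟩
  exact Finite.of_equiv _ (MulAction.orbitEquivQuotientStabilizer Γ ((s : G) : G ⧸ Γ)).symm

theorem out_mem {s : Δ} {x : G ⧸ Γ} (hx : x ∈ cosets Γ (s : G)) : x.out ∈ Δ := by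
  obtain ⟨γ, rfl⟩ := hx
  obtain ⟨δ, hδ⟩ := QuotientGroup.mk_out_eq_mul Γ ((γ : G) * (s : G))
  change Quotient.out (((γ : G) * (s : G) : G) : G ⧸ Γ) ∈ Δ
  rw [hδ]
  exact Δ.mul_mem (Δ.mul_mem (IsHeckeTriple.mem_of_mem_left Γ γ.2) s.2)
    (IsHeckeTriple.mem_of_mem_left Γ δ.2)

/-- The chosen representative `s_x ∈ Δ` of a left coset `x ⊆ Γ s Γ`, so that
`Γ s Γ = ⨆ s_x Γ` (disjointly). -/
def rep {s : Δ} (x : cosets Γ (s : G)) : Δ := ⟨x.1.out, out_mem Δ Γ x.2⟩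

/-- For `γ ∈ Γ` and a left coset `x`, the element `s_x⁻¹ γ s_y` of `Γ`, where `y = γ⁻¹ x`. -/
def transfer {s : Δ} (γ : Γ) (x : cosets Γ (s : G)) : Γ :=
  ⟨(rep Δ Γ x : G)⁻¹ * γ * (rep Δ Γ (γ⁻¹ • x) : G), by
    rw [mul_assoc, ← QuotientGroup.eq]
    have h : ((rep Δ Γ (γ⁻¹ • x) : G) : G ⧸ Γ) = γ⁻¹ • x.1 := Quotient.out_eq _
    have h' : (((γ : G) * (rep Δ Γ (γ⁻¹ • x) : G) : G) : G ⧸ Γ)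
        = γ • ((rep Δ Γ (γ⁻¹ • x) : G) : G ⧸ Γ) := rfl
    rw [h', h, smul_inv_smul]
    exact Quotient.out_eq _⟩

theorem rep_mul_transfer {s : Δ} (γ : Γ) (x : cosets Γ (s : G)) :
    (rep Δ Γ x : G) * transfer Δ Γ γ x = γ * (rep Δ Γ (γ⁻¹ • x) : G) := by
  simp [transfer, mul_assoc]

theorem transfer_mul {s : Δ} (γ δ : Γ) (x : cosets Γ (s : G)) :
    transfer Δ Γ (γ * δ) x = transfer Δ Γ γ x * transfer Δ Γ δ (γ⁻¹ • x) := by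
  apply Subtype.ext
  simp [transfer, mul_assoc, mul_smul]

/-- The inclusion of `Γ` in `Δ`. -/
def incl : Γ →* Δ where
  toFun γ := ⟨γ, IsHeckeTriple.mem_of_mem_left Γ γ.2⟩
  map_one' := rfl
  map_mul' _ _ := rfl

theorem rep_mul_incl {s : Δ} (γ : Γ) (x : cosets Γ (s : G)) :
    rep Δ Γ x * incl Δ Γ (transfer Δ Γ γ x) = incl Δ Γ γ * rep Δ Γ (γ⁻¹ • x) :=
  Subtype.ext (rep_mul_transfer Δ Γ γ x)

end Cosets

section Operators

variable {G k : Type u} [Group G] [CommRing k] {Δ : Submonoid G} (Γ : Subgroup G)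
  [hΓ : IsHeckeTriple Δ Γ Γ] {A : Type u} [AddCommGroup A] [Module k A]
  (ρ : Representation k Δ A)

/-- A `k[Δ]`-module regarded as a `k[Γ]`-module. -/
abbrev res : Rep.{u} k Γ := Rep.of (ρ.comp (incl Δ Γ))

open Classical in
instance (s : Δ) : Fintype (cosets Γ (s : G)) :=
  have := finite_cosets Δ Γ s
  Fintype.ofFinite _

/-- The action of the double coset `Γ s Γ = ⨆ s_x Γ` on inhomogeneous 1-cochains:
`(T z)(γ) = ∑ x, s_x • z (s_x⁻¹ γ s_y)`, where `y = γ⁻¹ x`. -/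
def cochainOp (s : Δ) : (Γ → A) →ₗ[k] (Γ → A) where
  toFun z γ := ∑ x : cosets Γ (s : G), ρ (rep Δ Γ x) (z (transfer Δ Γ γ x))
  map_add' z w := by ext γ; simp [Finset.sum_add_distrib]
  map_smul' c z := by ext γ; simp [Finset.smul_sum]

theorem cochainOp_mem_cocycles (s : Δ) {z : Γ → A}
    (hz : z ∈ groupCohomology.cocycles₁ (res Γ ρ)) :
    cochainOp Γ ρ s z ∈ groupCohomology.cocycles₁ (res Γ ρ) := by
  rw [groupCohomology.mem_cocycles₁_iff] at hz ⊢
  intro γ δ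
  change ∑ x : cosets Γ (s : G), ρ (rep Δ Γ x) (z (transfer Δ Γ (γ * δ) x))
    = ρ (incl Δ Γ γ) (∑ x : cosets Γ (s : G), ρ (rep Δ Γ x) (z (transfer Δ Γ δ x)))
      + ∑ x : cosets Γ (s : G), ρ (rep Δ Γ x) (z (transfer Δ Γ γ x))
  rw [map_sum, ← Equiv.sum_comp (MulAction.toPerm (γ⁻¹ : Γ))
    (fun x : cosets Γ (s : G) => ρ (incl Δ Γ γ) (ρ (rep Δ Γ x) (z (transfer Δ Γ δ x)))),
    ← Finset.sum_add_distrib]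
  refine Finset.sum_congr rfl fun x _ => ?_
  have h : z (transfer Δ Γ γ x * transfer Δ Γ δ (γ⁻¹ • x))
      = ρ (incl Δ Γ (transfer Δ Γ γ x)) (z (transfer Δ Γ δ (γ⁻¹ • x)))
        + z (transfer Δ Γ γ x) := hz _ _
  rw [transfer_mul, h, map_add, MulAction.toPerm_apply, ← Module.End.mul_apply, ← map_mul,
    rep_mul_incl, map_mul, Module.End.mul_apply]

theorem cochainOp_mem_coboundaries (s : Δ) {z : Γ → A}
    (hz : z ∈ groupCohomology.coboundaries₁ (res Γ ρ)) :
    cochainOp Γ ρ s z ∈ groupCohomology.coboundaries₁ (res Γ ρ) := by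
  obtain ⟨m, rfl⟩ := hz
  refine ⟨∑ x : cosets Γ (s : G), ρ (rep Δ Γ x) m, ?_⟩
  ext γ
  change ρ (incl Δ Γ γ) (∑ x : cosets Γ (s : G), ρ (rep Δ Γ x) m)
      - ∑ x : cosets Γ (s : G), ρ (rep Δ Γ x) m
    = ∑ x : cosets Γ (s : G), ρ (rep Δ Γ x) (ρ (incl Δ Γ (transfer Δ Γ γ x)) m - m)
  simp only [map_sub, Finset.sum_sub_distrib]
  congr 1
  rw [map_sum, ← Equiv.sum_comp (MulAction.toPerm (γ⁻¹ : Γ))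
    (fun x : cosets Γ (s : G) => ρ (incl Δ Γ γ) (ρ (rep Δ Γ x) m))]
  refine Finset.sum_congr rfl fun x _ => ?_
  rw [MulAction.toPerm_apply, ← Module.End.mul_apply, ← Module.End.mul_apply, ← map_mul,
    ← map_mul, rep_mul_incl]

/-- The first cohomology `H¹(Γ, A)` of a `k[Δ]`-module `A`. -/
abbrev H1 : ModuleCat.{u} k := groupCohomology.H1 (res Γ ρ)

/-- The projection from 1-cocycles to `H¹(Γ, A)`, as a linear map. -/
abbrev proj : groupCohomology.cocycles₁ (res Γ ρ) →ₗ[k] H1 Γ ρ :=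
  (groupCohomology.H1π (res Γ ρ)).hom

theorem proj_surjective : Function.Surjective (proj Γ ρ) :=
  (ModuleCat.epi_iff_surjective _).1 inferInstance

/-- The action of the double coset `Γ s Γ` on 1-cocycles. -/
def cocycleOp (s : Δ) :
    groupCohomology.cocycles₁ (res Γ ρ) →ₗ[k] groupCohomology.cocycles₁ (res Γ ρ) :=
  (cochainOp Γ ρ s).restrict fun _ hz => cochainOp_mem_cocycles Γ ρ s hz

theorem ker_proj_le (s : Δ) :
    LinearMap.ker (proj Γ ρ) ≤ (LinearMap.ker (proj Γ ρ)).comap (cocycleOp Γ ρ s) := by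
  intro z hz
  rw [Submodule.mem_comap, LinearMap.mem_ker]
  rw [LinearMap.mem_ker] at hz
  exact (groupCohomology.H1π_eq_zero_iff _).2
    (cochainOp_mem_coboundaries Γ ρ s ((groupCohomology.H1π_eq_zero_iff z).1 hz))

/-- The Hecke operator on `H¹(Γ, A)` given by the double coset `Γ s Γ`. -/
def heckeOp (s : Δ) : H1 Γ ρ →ₗ[k] H1 Γ ρ :=
  let e := (proj Γ ρ).quotKerEquivOfSurjective (proj_surjective Γ ρ)
  e.toLinearMap ∘ₗ Submodule.mapQ _ _ (cocycleOp Γ ρ s) (ker_proj_le Γ ρ s) ∘ₗ e.symm.toLinearMap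

/-- The Hecke operator on `H¹(Γ, A)` is induced by the operator on cocycles. -/
theorem heckeOp_proj (s : Δ) (z : groupCohomology.cocycles₁ (res Γ ρ)) :
    heckeOp Γ ρ s (proj Γ ρ z) = proj Γ ρ (cocycleOp Γ ρ s z) := by
  have h : ((proj Γ ρ).quotKerEquivOfSurjective (proj_surjective Γ ρ)).symm (proj Γ ρ z)
      = Submodule.Quotient.mk z := by
    rw [LinearEquiv.symm_apply_eq]
    rfl
  simp only [heckeOp, LinearMap.comp_apply, LinearEquiv.coe_coe, h]
  rfl

/-- The class `c ∈ H¹(Γ, A)` is a Hecke eigenclass with system of eigenvalues `a`: it is nonzero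
and `T c = a s • c` for the Hecke operator `T` of every double coset `Γ s Γ` with `s ∈ Δ`. -/
def IsEigenclass (a : Δ → k) (c : H1 Γ ρ) : Prop :=
  c ≠ 0 ∧ ∀ s : Δ, heckeOp Γ ρ s c = a s • c

end Operators

end HeckeH1

/-! ## The group `Γ₀(N)`, its Hecke semigroup, and coefficient modules -/

/-- `Γ₀(N) ⊆ SL₂(ℤ)`: the matrices whose first row is congruent to `(*, 0)` modulo `N`. -/
def Gamma0Row (N : ℕ) : Subgroup SL(2, ℤ) where
  carrier := {g | (N : ℤ) ∣ g 0 1}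
  one_mem' := by simp
  mul_mem' {a b} ha hb := by
    have h := (Matrix.two_mul_expl a.1 b.1).2.1
    change (N : ℤ) ∣ (a.1 * b.1) 0 1
    rw [h]
    exact dvd_add (Dvd.dvd.mul_left hb _) (Dvd.dvd.mul_right ha _)
  inv_mem' {a} ha := by
    change (N : ℤ) ∣ (a⁻¹ : SL(2, ℤ)) 0 1
    rw [Matrix.SpecialLinearGroup.SL2_inv_expl a]
    exact (dvd_neg (a := (N : ℤ)) (b := a 0 1)).2 ha

/-- `Γ₀(N)` as a subgroup of `GL₂(ℚ)`. -/
abbrev Gamma0Q (N : ℕ) : Subgroup (GL (Fin 2) ℚ) :=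
  (Gamma0Row N).map (Matrix.SpecialLinearGroup.mapGL ℚ)

/-- The semigroup of integral matrices in `GL₂(ℚ)` whose first row is congruent to `(*, 0)` modulo
`N` and whose determinant is positive and prime to `pN`. -/
def heckeSemigroup (p N : ℕ) : Submonoid (GL (Fin 2) ℚ) where
  carrier := {g | ∃ m : Matrix (Fin 2) (Fin 2) ℤ, (Int.castRingHom ℚ).mapMatrix m = g.1 ∧
    (N : ℤ) ∣ m 0 1 ∧ 0 < m.det ∧ IsCoprime m.det ((p * N : ℕ) : ℤ)}
  one_mem' := ⟨1, by simp, by simp, by simp, by simpa using isCoprime_one_left⟩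
  mul_mem' := by
    rintro g h ⟨m, hm, hm1, hm2, hm3⟩ ⟨n, hn, hn1, hn2, hn3⟩
    refine ⟨m * n, by rw [map_mul, hm, hn]; rfl, ?_, ?_, ?_⟩
    · rw [(Matrix.two_mul_expl m n).2.1]
      exact dvd_add (Dvd.dvd.mul_left hn1 _) (Dvd.dvd.mul_right hm1 _)
    · rw [Matrix.det_mul]
      exact mul_pos hm2 hn2
    · rw [Matrix.det_mul]
      exact hm3.mul_left hn3

theorem gamma_le_gamma0Row (N : ℕ) : CongruenceSubgroup.Gamma N ≤ Gamma0Row N := by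
  intro g hg
  exact (ZMod.intCast_zmod_eq_zero_iff_dvd _ _).1 (CongruenceSubgroup.Gamma_mem.1 hg).2.1

theorem gamma0Q_relIndex (N : ℕ) [NeZero N] (g : GL (Fin 2) ℚ) :
    (ConjAct.toConjAct g • Gamma0Q N).relIndex (Gamma0Q N) ≠ 0 := by
  obtain ⟨M, hM, h⟩ := CongruenceSubgroup.exists_Gamma_le_conj g⁻¹ N
  have : NeZero M := ⟨hM⟩
  have hle : (CongruenceSubgroup.Gamma M).map (Matrix.SpecialLinearGroup.mapGL ℚ)
      ≤ ConjAct.toConjAct g • Gamma0Q N := by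
    rintro _ ⟨x, hx, rfl⟩
    rw [Subgroup.mem_pointwise_smul_iff_inv_smul_mem, ← ConjAct.toConjAct_inv,
      ConjAct.toConjAct_smul]
    exact Subgroup.map_mono (gamma_le_gamma0Row N) (h x hx)
  have h1 : ((CongruenceSubgroup.Gamma M).map
      (Matrix.SpecialLinearGroup.mapGL ℚ)).relIndex (Gamma0Q N) ≠ 0 := by
    rw [← Subgroup.relIndex_comap, Subgroup.comap_map_eq_self_of_injective
      Matrix.SpecialLinearGroup.mapGL_injective]
    have := CongruenceSubgroup.Gamma_normal M
    have : (CongruenceSubgroup.Gamma M).FiniteIndex :=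
      (CongruenceSubgroup.Gamma_is_cong_sub M).finiteIndex
    exact fun h0 => this.index_ne_zero
      (Nat.eq_zero_of_zero_dvd (h0 ▸ Subgroup.relIndex_dvd_index_of_normal _ _))
  exact fun h0 => h1 (Nat.eq_zero_of_zero_dvd (h0 ▸ Subgroup.relIndex_dvd_of_le_left _ hle))

/-- `Γ₀(N)` and its Hecke semigroup form a Hecke pair. -/
instance (p N : ℕ) [NeZero N] : IsHeckeTriple (heckeSemigroup p N) (Gamma0Q N) (Gamma0Q N) :=
  IsHeckeTriple.of_diagonal
    (by
      rintro _ ⟨g, hg, rfl⟩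
      exact ⟨g.1, rfl, hg, by simp [g.2], by simpa [g.2] using isCoprime_one_left⟩)
    (by
      intro g _
      change Subgroup.Commensurable (ConjAct.toConjAct g • Gamma0Q N) (Gamma0Q N)
      refine ⟨gamma0Q_relIndex N g, ?_⟩
      rw [← Subgroup.relIndex_pointwise_smul (ConjAct.toConjAct g)⁻¹, inv_smul_smul,
        ← ConjAct.toConjAct_inv]
      exact gamma0Q_relIndex N g⁻¹)

/-- The integral matrix underlying an element of the Hecke semigroup. -/
def intMatrix {p N : ℕ} (s : heckeSemigroup p N) : Matrix (Fin 2) (Fin 2) ℤ := s.2.choose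

theorem intMatrix_spec {p N : ℕ} (s : heckeSemigroup p N) :
    (Int.castRingHom ℚ).mapMatrix (intMatrix s) = s.1.1 ∧ (N : ℤ) ∣ intMatrix s 0 1 ∧
      0 < (intMatrix s).det ∧ IsCoprime (intMatrix s).det ((p * N : ℕ) : ℤ) :=
  s.2.choose_spec

theorem intMatrix_eq {p N : ℕ} (s : heckeSemigroup p N) (m : Matrix (Fin 2) (Fin 2) ℤ)
    (hm : (Int.castRingHom ℚ).mapMatrix m = s.1.1) : intMatrix s = m := by
  have h := (intMatrix_spec s).1.trans hm.symm
  ext i j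
  have h' := congrFun (congrFun h i) j
  simpa using h'

theorem det_intMatrix_ne_zero {p N : ℕ} (F : Type*) [Field F] [CharP F p]
    (s : heckeSemigroup p N) : ((Int.castRingHom F).mapMatrix (intMatrix s)).det ≠ 0 := by
  rw [← RingHom.map_det]
  intro h
  have h1 : (p : ℤ) ∣ (intMatrix s).det := (CharP.intCast_eq_zero_iff F p _).1 h
  have h2 : IsUnit (p : ℤ) := (intMatrix_spec s).2.2.2.isUnit_of_dvd' h1
    (by push_cast; exact dvd_mul_right _ _)
  have h3 : p = 1 := by simpa using Int.isUnit_iff_natAbs_eq.1 h2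
  exact CharP.char_ne_one F p h3

/-- Reduction modulo `p` from the Hecke semigroup to `GL₂(F)`, `F` a field of characteristic `p`. -/
def reduction (p N : ℕ) (F : Type*) [Field F] [CharP F p] :
    heckeSemigroup p N →* GL (Fin 2) F where
  toFun s := Matrix.GeneralLinearGroup.mkOfDetNeZero _ (det_intMatrix_ne_zero F s)
  map_one' := by
    apply Units.ext
    change (Int.castRingHom F).mapMatrix (intMatrix 1) = 1
    rw [intMatrix_eq (1 : heckeSemigroup p N) 1 (map_one _), map_one]
  map_mul' s t := by
    apply Units.ext
    change (Int.castRingHom F).mapMatrix (intMatrix (s * t))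
      = (Int.castRingHom F).mapMatrix (intMatrix s) * (Int.castRingHom F).mapMatrix (intMatrix t)
    rw [← map_mul, intMatrix_eq (s * t) (intMatrix s * intMatrix t)]
    rw [map_mul, (intMatrix_spec s).1, (intMatrix_spec t).1]
    rfl

section Modules

variable {p : ℕ} [Fact p.Prime]

/-- A `GL₂(F)`-module over `𝔽̄_p` regarded as a module over the Hecke semigroup of `Γ₀(N)`, which
acts through reduction modulo `p`. -/
abbrev heckeModule (N : ℕ) {F : Type*} [Field F] [CharP F p] {V : Type} [AddCommGroup V]
    [Module (AlgebraicClosure (ZMod p)) V]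
    (ρ : Representation (AlgebraicClosure (ZMod p)) (GL (Fin 2) F) V) :
    Representation (AlgebraicClosure (ZMod p)) (heckeSemigroup p N) V :=
  ρ.comp (reduction p N F)

/-- The character `s ↦ det s mod p` of the Hecke semigroup, with values in `𝔽̄_p`. -/
def detChar (N : ℕ) (s : heckeSemigroup p N) : AlgebraicClosure (ZMod p) :=
  ((intMatrix s).det : AlgebraicClosure (ZMod p))

/-- A class in `H¹(Γ₀(N), V)` is a twist of a punctual eigenclass. A punctual eigenclass is one on
which every double coset acts as multiplication by its degree, as it does on the cohomology
`H⁰(Γ₀(N), 𝔽̄_p)` of a point; twisting by the `j`-th power of the determinant (that is, replacing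
the coefficients `V` by `V ⊗ det ^ j`) multiplies the eigenvalue at `Γ s Γ` by `(det s) ^ j`. -/
def IsTwistOfPunctual (N : ℕ) [NeZero N] {F : Type*} [Field F] [CharP F p] {V : Type}
    [AddCommGroup V] [Module (AlgebraicClosure (ZMod p)) V]
    (ρ : Representation (AlgebraicClosure (ZMod p)) (GL (Fin 2) F) V)
    (c : HeckeH1.H1 (Gamma0Q N) (heckeModule N ρ)) : Prop :=
  ∃ j : ℤ, HeckeH1.IsEigenclass (Gamma0Q N) (heckeModule N ρ)
    (fun s => detChar N s ^ j * (HeckeH1.degree (Gamma0Q N) s.1 : AlgebraicClosure (ZMod p))) c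

end Modules

/-- The representation on `A` is a subquotient of the representation on `B`: it is isomorphic to
`S / T` for subrepresentations `T ⊆ S ⊆ B`. -/
def IsSubquotient {k H A B : Type*} [CommRing k] [Monoid H] [AddCommGroup A] [Module k A]
    [AddCommGroup B] [Module k B] (ρA : Representation k H A) (ρB : Representation k H B) : Prop :=
  ∃ S T : Subrepresentation ρB, T ≤ S ∧ Nonempty
    ((S.toRepresentation.quotient (T.toSubmodule.comap S.toSubmodule.subtype)
      (fun g _ hx => T.apply_mem_toSubmodule g hx)).Equiv ρA)

end

/-! Let `A = S/T` with `S ⊆ B`. The system of eigenvalues is lifted from `A` to `S` and then pushed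
into `B`.

From `A` to `S`: the Sanov free group meets `Γ₀(N)` in a free subgroup of index dividing 12.
Cocycles on a free group lift along surjections, and 12 is invertible because `p > 3`, so
corestriction shows that `H¹(S) → H¹(A)` is onto (`mapH1_surjective`). A preimage of `α` need not be
an eigenclass. However, the Hecke operators commute (`heckeOp_comm`, by Gelfand's trick with an
anti-involution preserving double cosets), and every class lies in a finite-dimensional stable
subspace (`exists_finiteDimensional_stable`), since `Γ₀(N)` is finitely generated and `Δ` acts on
coefficients through a finite set. Linear algebra (`exists_eigenvector_of_map`) then gives an
eigenclass `w` in `H¹(S)` with the eigenvalues of `α`.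

From `S` to `B`: if `w` dies in `H¹(B)`, it comes from a `Γ₀(N)`-invariant of `B/S` through the
connecting map. Elements of `Δ` with the same determinant modulo `p` have reductions differing by an
element of `Γ₀(N)`, so `Δ` acts on these invariants through `𝔽_pˣ`, whose order is prime to `p`.
Splitting into characters shows that the eigenvalues are `det(s)^j deg(s)`
(`exists_eq_detChar_pow_mul_degree`), which is excluded for `α`. -/

noncomputable section

namespace HeckeH1

/-! ### Double cosets and Gelfand's trick. -/

section DoubleCosets

variable {G : Type u} [Group G] (Γ : Subgroup G)

/-- `g` lies in the double coset `Γ s Γ`. -/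
def InDoubleCoset (s g : G) : Prop := ∃ γ ∈ Γ, ∃ δ ∈ Γ, g = γ * s * δ

variable {Γ}

theorem mk_mem_cosets_iff {s g : G} : (g : G ⧸ Γ) ∈ cosets Γ s ↔ InDoubleCoset Γ s g := by
  constructor
  · rintro ⟨γ, hγ⟩
    have h : (((γ : G) * s : G) : G ⧸ Γ) = g := hγ
    rw [QuotientGroup.eq] at h
    exact ⟨γ, γ.2, _, h, by group⟩
  · rintro ⟨γ, hγ, δ, hδ, rfl⟩
    refine ⟨⟨γ, hγ⟩, ?_⟩
    change ((γ * s : G) : G ⧸ Γ) = _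
    rw [QuotientGroup.eq]
    simpa [mul_assoc] using hδ

theorem InDoubleCoset.mul_left {s g γ : G} (h : InDoubleCoset Γ s g) (hγ : γ ∈ Γ) :
    InDoubleCoset Γ s (γ * g) := by
  obtain ⟨a, ha, b, hb, rfl⟩ := h
  exact ⟨γ * a, mul_mem hγ ha, b, hb, by group⟩

theorem InDoubleCoset.mul_right {s g γ : G} (h : InDoubleCoset Γ s g) (hγ : γ ∈ Γ) :
    InDoubleCoset Γ s (g * γ) := by
  obtain ⟨a, ha, b, hb, rfl⟩ := h
  exact ⟨a, ha, b * γ, mul_mem hb hγ, by group⟩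

variable (Δ : Submonoid G)

/-- An anti-endomorphism of `G` that preserves `Γ` and every double coset `Γ s Γ` with `s ∈ Δ`. -/
structure IsDoubleCosetInvolution (Γ : Subgroup G) (ι : G → G) : Prop where
  map_mul : ∀ g h, ι (g * h) = ι h * ι g
  map_mem_iff : ∀ g, ι g ∈ Γ ↔ g ∈ Γ
  inDoubleCoset : ∀ s ∈ Δ, InDoubleCoset Γ s (ι s)

variable {Δ} {ι : G → G} (hι : IsDoubleCosetInvolution Δ Γ ι)

include hι

theorem IsDoubleCosetInvolution.map_one : ι 1 = 1 := by
  have h := hι.map_mul 1 1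
  rw [mul_one] at h
  exact left_eq_mul.1 h

theorem IsDoubleCosetInvolution.map_inv (g : G) : ι g⁻¹ = (ι g)⁻¹ := by
  rw [eq_inv_iff_mul_eq_one, ← hι.map_mul, mul_inv_cancel, hι.map_one]

theorem IsDoubleCosetInvolution.apply_inDoubleCoset {s g : G} (hs : s ∈ Δ)
    (h : InDoubleCoset Γ s g) : InDoubleCoset Γ s (ι g) := by
  obtain ⟨a, ha, b, hb, rfl⟩ := h
  rw [hι.map_mul, hι.map_mul]
  exact ((hι.inDoubleCoset s hs).mul_right ((hι.map_mem_iff a).2 ha)).mul_left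
    ((hι.map_mem_iff b).2 hb)

variable [hΓ : IsHeckeTriple Δ Γ Γ]

omit hι in
theorem mk_rep {s : Δ} (x : cosets Γ (s : G)) : ((rep Δ Γ x : G) : G ⧸ Γ) = x.1 :=
  Quotient.out_eq _

omit hι in
theorem rep_inDoubleCoset {s : Δ} (x : cosets Γ (s : G)) :
    InDoubleCoset Γ (s : G) (rep Δ Γ x : G) :=
  mk_mem_cosets_iff.1 (by rw [mk_rep]; exact x.2)

/-- The coset of the product of representatives. -/
def prodCoset (s t : Δ) (x : cosets Γ (s : G) × cosets Γ (t : G)) : G ⧸ Γ :=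
  (((rep Δ Γ x.1 : G) * (rep Δ Γ x.2 : G) : G) : G ⧸ Γ)

/-- For `c = uΓ`, a point of the fibre is a coset `x` in `ΓsΓ` with `s_x⁻¹ u ∈ ΓtΓ`. Applying `ι`
reverses the product, and `ι u = γ u δ` turns this into `u δ ι(s_x)⁻¹ ∈ ΓtΓ`: this is the first
factor of a factorization of `u` in the opposite order. -/
theorem exists_injective_fiber (s t : Δ) (c : G ⧸ Γ) :
    ∃ φ : {x // prodCoset s t x = c} → {y // prodCoset t s y = c}, Function.Injective φ := by
  rcases isEmpty_or_nonempty {x // prodCoset (Γ := Γ) s t x = c} with h0 | ⟨⟨x0, hx0⟩⟩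
  · exact ⟨fun x => h0.elim x, fun x => h0.elim x⟩
  obtain ⟨u, hu, rfl⟩ : ∃ u ∈ Δ, (u : G ⧸ Γ) = c :=
    ⟨_, mul_mem (rep Δ Γ x0.1).2 (rep Δ Γ x0.2).2, hx0⟩
  obtain ⟨γ, hγ, δ, hδ, hιu⟩ := hι.inDoubleCoset u hu
  have hquot : ∀ x : {x // prodCoset (Γ := Γ) s t x = u},
      InDoubleCoset Γ (t : G) ((rep Δ Γ x.1.1 : G)⁻¹ * u) := by
    intro x
    have h1 := QuotientGroup.eq.1 x.2
    rw [mul_inv_rev] at h1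
    have h2 := (rep_inDoubleCoset x.1.2).mul_right h1
    convert h2 using 1
    group
  have hz : ∀ x : {x // prodCoset (Γ := Γ) s t x = u},
      ((u * δ * (ι (rep Δ Γ x.1.1 : G))⁻¹ : G) : G ⧸ Γ) ∈ cosets Γ (t : G) := by
    intro x
    rw [mk_mem_cosets_iff]
    have h1 := (hι.apply_inDoubleCoset t.2 (hquot x)).mul_left (inv_mem hγ)
    rw [hι.map_mul, hι.map_inv, hιu] at h1
    convert h1 using 1
    group
  let z : ∀ x : {x // prodCoset (Γ := Γ) s t x = u}, cosets Γ (t : G) := fun x => ⟨_, hz x⟩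
  have hy : ∀ x : {x // prodCoset (Γ := Γ) s t x = u},
      (((rep Δ Γ (z x) : G)⁻¹ * u : G) : G ⧸ Γ) ∈ cosets Γ (s : G) := by
    intro x
    rw [mk_mem_cosets_iff]
    have h1 : ((rep Δ Γ (z x) : G) : G ⧸ Γ)
        = ((u * δ * (ι (rep Δ Γ x.1.1 : G))⁻¹ : G) : G ⧸ Γ) := mk_rep (z x)
    rw [QuotientGroup.eq] at h1
    have h2 := ((hι.apply_inDoubleCoset s.2 (rep_inDoubleCoset x.1.1)).mul_left h1).mul_right
      (inv_mem hδ)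
    convert h2 using 1
    group
  refine ⟨fun x => ⟨(z x, ⟨_, hy x⟩), ?_⟩, ?_⟩
  · have h1 := mk_rep (Δ := Δ) (⟨_, hy x⟩ : cosets Γ (s : G))
    change (((rep Δ Γ (z x) : G) * (rep Δ Γ (⟨_, hy x⟩ : cosets Γ (s : G)) : G) : G) : G ⧸ Γ) = _
    rw [QuotientGroup.eq] at h1 ⊢
    convert h1 using 1
    group
  · intro x x' hxx
    have h1 : z x = z x' := congrArg (fun w => w.1.1) hxx
    have h2 : ((u * δ * (ι (rep Δ Γ x.1.1 : G))⁻¹ : G) : G ⧸ Γ)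
        = ((u * δ * (ι (rep Δ Γ x'.1.1 : G))⁻¹ : G) : G ⧸ Γ) := congrArg Subtype.val h1
    have h3 : x.1.1 = x'.1.1 := by
      apply Subtype.ext
      rw [← mk_rep (Δ := Δ) x.1.1, ← mk_rep (Δ := Δ) x'.1.1, eq_comm, QuotientGroup.eq,
        ← hι.map_mem_iff, hι.map_mul, hι.map_inv]
      rw [QuotientGroup.eq] at h2
      convert h2 using 1
      group
    have h4 : x.1.2 = x'.1.2 := by
      apply Subtype.ext
      rw [← mk_rep (Δ := Δ) x.1.2, ← mk_rep (Δ := Δ) x'.1.2]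
      have h5 : prodCoset s t x.1 = prodCoset s t x'.1 := x.2.trans x'.2.symm
      unfold prodCoset at h5
      rw [h3] at h5
      rw [QuotientGroup.eq] at h5 ⊢
      convert h5 using 1
      group
    exact Subtype.ext (Prod.ext h3 h4)

/-- The structure constants of the two products of double cosets agree. The fibrewise bijection
comes from Schröder–Bernstein; it is kept as an equivalence so that sums over pairs of
representatives can be reindexed. -/
theorem exists_equiv_prodCoset (s t : Δ) :
    ∃ e : cosets Γ (s : G) × cosets Γ (t : G) ≃ cosets Γ (t : G) × cosets Γ (s : G),
      ∀ x, prodCoset t s (e x) = prodCoset s t x := by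
  have := finite_cosets Δ Γ s
  have := finite_cosets Δ Γ t
  have h : ∀ c : G ⧸ Γ, Nonempty ({x // prodCoset s t x = c} ≃ {y // prodCoset t s y = c}) := by
    intro c
    obtain ⟨φ, hφ⟩ := exists_injective_fiber hι s t c
    obtain ⟨ψ, hψ⟩ := exists_injective_fiber hι t s c
    exact ⟨(Function.Embedding.antisymm ⟨φ, hφ⟩ ⟨ψ, hψ⟩).some⟩
  exact ⟨Equiv.ofFiberEquiv fun c => (h c).some, fun x => Equiv.ofFiberEquiv_map _ x⟩

end DoubleCosets

/-! ### Primitives of cocycles and commutativity of the Hecke operators. -/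

section Cohomology

variable {G k : Type u} [Group G] [CommRing k] {Δ : Submonoid G} (Γ : Subgroup G)
  [hΓ : IsHeckeTriple Δ Γ Γ] {A : Type u} [AddCommGroup A] [Module k A]
  (ρ : Representation k Δ A)

theorem mem_cocycles_iff (z : Γ → A) :
    z ∈ groupCohomology.cocycles₁ (res Γ ρ) ↔
      ∀ γ δ : Γ, z (γ * δ) = ρ (incl Δ Γ γ) (z δ) + z γ :=
  groupCohomology.mem_cocycles₁_iff (A := res Γ ρ) z

theorem proj_eq_zero_iff (z : groupCohomology.cocycles₁ (res Γ ρ)) :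
    proj Γ ρ z = 0 ↔ ∃ m : A, ∀ γ : Γ, ρ (incl Δ Γ γ) m - m = z.1 γ := by
  refine (groupCohomology.H1π_eq_zero_iff z).trans ⟨?_, ?_⟩
  · rintro ⟨m, hm⟩
    exact ⟨m, fun γ => congrFun hm γ⟩
  · rintro ⟨m, hm⟩
    exact ⟨m, funext hm⟩

/-- The primitives of a cocycle `z` in the `Γ`-module of functions `G → A`. -/
def IsPrimitive (z : Γ → A) (f : G → A) : Prop :=
  ∀ (γ : Γ) (g : G), ρ (incl Δ Γ γ) (f ((γ : G)⁻¹ * g)) - f g = z γ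

variable {ρ}

/-- `Γ` acts freely on `G`, so the functions `G → A` have no first cohomology. With `r g` a
representative of `Γ g`, the function `g ↦ -z (g (r g)⁻¹)` is a primitive. -/
theorem exists_isPrimitive {z : Γ → A} (hz : z ∈ groupCohomology.cocycles₁ (res Γ ρ)) :
    ∃ f : G → A, IsPrimitive Γ ρ z f := by
  rw [mem_cocycles_iff] at hz
  let r : G → G := fun g => (Quotient.mk (QuotientGroup.rightRel Γ) g).out
  have hr : ∀ g, g * (r g)⁻¹ ∈ Γ := fun g =>
    QuotientGroup.rightRel_apply.1 (Quotient.exact (Quotient.out_eq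
      (Quotient.mk (QuotientGroup.rightRel Γ) g)))
  have hr' : ∀ (γ : Γ) (g : G), r ((γ : G)⁻¹ * g) = r g := fun γ g => by
    change Quotient.out _ = Quotient.out _
    congr 1
    refine Quotient.sound (QuotientGroup.rightRel_apply.2 ?_)
    simp
  refine ⟨fun g => - z ⟨_, hr g⟩, fun γ g => ?_⟩
  have h : (⟨_, hr g⟩ : Γ) = γ * ⟨_, hr ((γ : G)⁻¹ * g)⟩ := by
    apply Subtype.ext
    simp [hr', mul_assoc]
  beta_reduce
  rw [h, hz]
  simp

variable {Γ}

/-- On primitives the Hecke operator is a plain sum of translates, without transfer elements, so a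
composite of two is a sum over products of representatives. -/
theorem IsPrimitive.cochainOp {z : Γ → A} {f : G → A} (hf : IsPrimitive Γ ρ z f) (s : Δ) :
    IsPrimitive Γ ρ (cochainOp Γ ρ s z)
      (fun g => ∑ x : cosets Γ (s : G), ρ (rep Δ Γ x) (f ((rep Δ Γ x : G)⁻¹ * g))) := by
  intro γ g
  change ρ (incl Δ Γ γ) (∑ x : cosets Γ (s : G), ρ (rep Δ Γ x)
      (f ((rep Δ Γ x : G)⁻¹ * ((γ : G)⁻¹ * g)))) - _
    = ∑ x : cosets Γ (s : G), ρ (rep Δ Γ x) (z (transfer Δ Γ γ x))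
  rw [map_sum, ← Equiv.sum_comp (MulAction.toPerm (γ⁻¹ : Γ)), ← Finset.sum_sub_distrib]
  refine Finset.sum_congr rfl fun x _ => ?_
  rw [MulAction.toPerm_apply, ← Module.End.mul_apply, ← map_mul, ← rep_mul_incl, map_mul,
    Module.End.mul_apply, ← map_sub, ← hf (transfer Δ Γ γ x) ((rep Δ Γ x : G)⁻¹ * g)]
  have h : (rep Δ Γ (γ⁻¹ • x) : G)⁻¹ * ((γ : G)⁻¹ * g)
      = (transfer Δ Γ γ x : G)⁻¹ * ((rep Δ Γ x : G)⁻¹ * g) := by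
    rw [← mul_assoc, ← mul_assoc, ← mul_inv_rev, ← mul_inv_rev, rep_mul_transfer]
  rw [h]

/-- Changing the representative of a left coset alters the translate of a primitive by a constant
function only, hence the cocycle by a coboundary. -/
theorem IsPrimitive.sub_eq_const {z : Γ → A} {f : G → A} (hf : IsPrimitive Γ ρ z f) {u v : Δ}
    (huv : ((u : G) : G ⧸ Γ) = ((v : G) : G ⧸ Γ)) :
    ∃ c : A, ∀ g, ρ v (f ((v : G)⁻¹ * g)) - ρ u (f ((u : G)⁻¹ * g)) = c := by
  let δ : Γ := ⟨_, QuotientGroup.eq.1 huv⟩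
  have hv : v = u * incl Δ Γ δ := Subtype.ext (by change (v : G) = u * ((u : G)⁻¹ * v); group)
  refine ⟨ρ u (z δ), fun g => ?_⟩
  rw [← hf δ ((u : G)⁻¹ * g), map_sub]
  congr 1
  have h : (v : G)⁻¹ * g = (δ : G)⁻¹ * ((u : G)⁻¹ * g) := by
    change _ = ((u : G)⁻¹ * v)⁻¹ * _
    group
  rw [h, ← Module.End.mul_apply, ← map_mul, ← hv]

/-- The primitives of the two composites are sums over pairs of representatives.
`exists_equiv_prodCoset` matches products in the same left coset, so the primitives differ by a
constant, whose coboundary is the difference of the cocycles. -/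
theorem heckeOp_comm {ι : G → G} (hι : IsDoubleCosetInvolution Δ Γ ι) (s t : Δ) (c : H1 Γ ρ) :
    heckeOp Γ ρ s (heckeOp Γ ρ t c) = heckeOp Γ ρ t (heckeOp Γ ρ s c) := by
  obtain ⟨z, rfl⟩ := proj_surjective Γ ρ c
  simp only [heckeOp_proj]
  obtain ⟨f, hf⟩ := exists_isPrimitive Γ z.2
  have hst := (hf.cochainOp t).cochainOp s
  have hts := (hf.cochainOp s).cochainOp t
  obtain ⟨e, he⟩ := exists_equiv_prodCoset hι s t
  have hconst : ∀ x : cosets Γ (s : G) × cosets Γ (t : G), ∃ c : A, ∀ g,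
      ρ (rep Δ Γ x.1 * rep Δ Γ x.2) (f (((rep Δ Γ x.1 * rep Δ Γ x.2 : Δ) : G)⁻¹ * g))
        - ρ (rep Δ Γ (e x).1 * rep Δ Γ (e x).2)
          (f (((rep Δ Γ (e x).1 * rep Δ Γ (e x).2 : Δ) : G)⁻¹ * g)) = c :=
    fun x => hf.sub_eq_const (he x)
  choose c hc using hconst
  rw [← sub_eq_zero, ← map_sub, proj_eq_zero_iff]
  refine ⟨∑ x, c x, fun γ => ?_⟩
  have hsum : ∀ g, (∑ x : cosets Γ (s : G), ρ (rep Δ Γ x) (∑ y : cosets Γ (t : G),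
        ρ (rep Δ Γ y) (f ((rep Δ Γ y : G)⁻¹ * ((rep Δ Γ x : G)⁻¹ * g)))))
      - (∑ y : cosets Γ (t : G), ρ (rep Δ Γ y) (∑ x : cosets Γ (s : G),
        ρ (rep Δ Γ x) (f ((rep Δ Γ x : G)⁻¹ * ((rep Δ Γ y : G)⁻¹ * g))))) = ∑ x, c x := by
    intro g
    simp only [map_sum, ← Module.End.mul_apply, ← map_mul, ← mul_assoc, ← mul_inv_rev]
    rw [← Fintype.sum_prod_type', ← Fintype.sum_prod_type', ← Equiv.sum_comp e,
      ← Finset.sum_sub_distrib]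
    exact Finset.sum_congr rfl fun x _ => hc x g
  have h1 : ρ (incl Δ Γ γ) (∑ x, c x) - ∑ x, c x
      = HeckeH1.cochainOp Γ ρ s (HeckeH1.cochainOp Γ ρ t z.1) γ
        - HeckeH1.cochainOp Γ ρ t (HeckeH1.cochainOp Γ ρ s z.1) γ := by
    have h2 := congrArg (ρ (incl Δ Γ γ)) (hsum ((γ : G)⁻¹ * 1))
    rw [map_sub] at h2
    rw [← hst γ 1, ← hts γ 1, ← h2, ← hsum 1]
    beta_reduce
    abel
  exact h1

end Cohomology

/-! ### Functoriality of `H¹` in the coefficients. -/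

section Functoriality

variable {G k : Type u} [Group G] [CommRing k] {Δ : Submonoid G} (Γ : Subgroup G)
  [hΓ : IsHeckeTriple Δ Γ Γ] {A B : Type u} [AddCommGroup A] [Module k A]
  [AddCommGroup B] [Module k B]
  {ρ : Representation k Δ A} {σ : Representation k Δ B}
  (φ : A →ₗ[k] B) (hφ : ∀ s a, φ (ρ s a) = σ s (φ a))

include hφ in
theorem comp_mem_cocycles {z : Γ → A} (hz : z ∈ groupCohomology.cocycles₁ (res Γ ρ)) :
    (fun γ => φ (z γ)) ∈ groupCohomology.cocycles₁ (res Γ σ) := by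
  rw [mem_cocycles_iff] at hz ⊢
  intro γ δ
  rw [hz, map_add, hφ]

/-- The map on 1-cocycles induced by a map of `k[Δ]`-modules. -/
def mapCocycles : groupCohomology.cocycles₁ (res Γ ρ) →ₗ[k] groupCohomology.cocycles₁ (res Γ σ) where
  toFun z := ⟨fun γ => φ (z.1 γ), comp_mem_cocycles Γ φ hφ z.2⟩
  map_add' _ _ := Subtype.ext (funext fun _ => map_add φ _ _)
  map_smul' _ _ := Subtype.ext (funext fun _ => map_smul φ _ _)

theorem ker_proj_le_ker_mapCocycles :
    LinearMap.ker (proj Γ ρ) ≤ LinearMap.ker (proj Γ σ ∘ₗ mapCocycles Γ φ hφ) := by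
  intro z hz
  rw [LinearMap.mem_ker, proj_eq_zero_iff] at hz
  obtain ⟨m, hm⟩ := hz
  rw [LinearMap.mem_ker, LinearMap.comp_apply, proj_eq_zero_iff]
  refine ⟨φ m, fun γ => ?_⟩
  change _ = φ (z.1 γ)
  rw [← hm, map_sub, hφ]

/-- The map on `H¹` induced by a map of `k[Δ]`-modules. -/
def mapH1 : H1 Γ ρ →ₗ[k] H1 Γ σ :=
  Submodule.liftQ _ _ (ker_proj_le_ker_mapCocycles Γ φ hφ) ∘ₗ
    ((proj Γ ρ).quotKerEquivOfSurjective (proj_surjective Γ ρ)).symm.toLinearMap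

theorem mapH1_proj (z : groupCohomology.cocycles₁ (res Γ ρ)) :
    mapH1 Γ φ hφ (proj Γ ρ z) = proj Γ σ (mapCocycles Γ φ hφ z) := by
  have h : ((proj Γ ρ).quotKerEquivOfSurjective (proj_surjective Γ ρ)).symm (proj Γ ρ z)
      = Submodule.Quotient.mk z := by
    rw [LinearEquiv.symm_apply_eq]
    rfl
  simp only [mapH1, LinearMap.comp_apply, LinearEquiv.coe_coe, h]
  rfl

theorem mapH1_heckeOp (s : Δ) (c : H1 Γ ρ) :
    mapH1 Γ φ hφ (heckeOp Γ ρ s c) = heckeOp Γ σ s (mapH1 Γ φ hφ c) := by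
  obtain ⟨z, rfl⟩ := proj_surjective Γ ρ c
  rw [heckeOp_proj, mapH1_proj, mapH1_proj, heckeOp_proj]
  congr 1
  apply Subtype.ext
  funext γ
  change φ (∑ x : cosets Γ (s : G), ρ (rep Δ Γ x) (z.1 (transfer Δ Γ γ x)))
    = ∑ x : cosets Γ (s : G), σ (rep Δ Γ x) (φ (z.1 (transfer Δ Γ γ x)))
  simp only [map_sum, hφ]

end Functoriality

end HeckeH1

/-! ### Eigenvectors of commuting families of operators. -/

section CommutingFamilies

variable {k M M' ι : Type*} [Field k] [AddCommGroup M] [Module k M] [AddCommGroup M'] [Module k M']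

/-- A commuting family of operators which is nilpotent on a nonzero finite-dimensional stable
subspace has a common kernel vector there. -/
theorem exists_forall_apply_eq_zero (f : ι → Module.End k M)
    (hcomm : ∀ i j v, f i (f j v) = f j (f i v)) (W : Submodule k M) [FiniteDimensional k W]
    (hW : W ≠ ⊥) (hstable : ∀ i, ∀ v ∈ W, f i v ∈ W) (hnil : ∀ i, ∀ v ∈ W, ∃ n : ℕ, (f i ^ n) v = 0) :
    ∃ v ∈ W, v ≠ 0 ∧ ∀ i, f i v = 0 := by
  let P : Submodule k M → Prop := fun U => U ≤ W ∧ U ≠ ⊥ ∧ ∀ i, ∀ v ∈ U, f i v ∈ U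
  obtain ⟨U, ⟨hUW, hU0, hUs⟩, hmin⟩ :
      ∃ U, P U ∧ ∀ V, P V → V ≤ U → Module.finrank k U ≤ Module.finrank k V := by
    have hne : ∃ n, ∃ U, P U ∧ Module.finrank k U = n := ⟨_, W, ⟨le_rfl, hW, hstable⟩, rfl⟩
    classical
    obtain ⟨U, hU, hn⟩ := Nat.find_spec hne
    exact ⟨U, hU, fun V hV _ => hn.trans_le (Nat.find_min' hne ⟨V, hV, rfl⟩)⟩
  have hUfin : FiniteDimensional k U := Submodule.finiteDimensional_of_le hUW
  obtain ⟨v, hv, hv0⟩ := Submodule.exists_mem_ne_zero_of_ne_bot hU0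
  refine ⟨v, hUW hv, hv0, fun i => ?_⟩
  -- By commutativity the kernel of `f i` on `U` is stable, and it is nonzero by nilpotence;
  -- minimality of `U` makes it all of `U`.
  have hK : P (U ⊓ LinearMap.ker (f i)) := by
    refine ⟨inf_le_left.trans hUW, ?_, ?_⟩
    · classical
      have hex := hnil i v (hUW hv)
      have hn0 : Nat.find hex ≠ 0 := fun h0 => hv0 (by simpa [h0] using Nat.find_spec hex)
      obtain ⟨m, hm⟩ := Nat.exists_eq_succ_of_ne_zero hn0
      have hmem : ∀ n : ℕ, (f i ^ n) v ∈ U := by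
        intro n
        induction n with
        | zero => simpa using hv
        | succ n ih =>
          rw [pow_succ', Module.End.mul_apply]
          exact hUs i _ ih
      intro hbot
      have h1 : (f i ^ m) v ∈ U ⊓ LinearMap.ker (f i) := by
        refine ⟨hmem m, ?_⟩
        have := Nat.find_spec hex
        rw [hm, pow_succ', Module.End.mul_apply] at this
        exact this
      rw [hbot, Submodule.mem_bot] at h1
      exact Nat.find_min hex (by omega) h1
    · rintro j w ⟨hw, hwk⟩
      refine ⟨hUs j w hw, ?_⟩
      rw [SetLike.mem_coe, LinearMap.mem_ker] at hwk
      rw [SetLike.mem_coe, LinearMap.mem_ker, hcomm, hwk, map_zero]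
  have heq : U ⊓ LinearMap.ker (f i) = U :=
    Submodule.eq_of_le_of_finrank_le inf_le_left (hmin _ hK inf_le_left)
  rw [← heq] at hv
  exact hv.2

/-- Lifting of systems of eigenvalues along a map of modules over a commuting family of
operators, for a vector which lies in a finite-dimensional stable subspace. -/
theorem exists_eigenvector_of_map (f : ι → Module.End k M) (g : ι → Module.End k M')
    (hcomm : ∀ i j v, f i (f j v) = f j (f i v)) (π : M →ₗ[k] M')
    (hπ : ∀ i v, π (f i v) = g i (π v)) (a : ι → k) (W : Submodule k M) [FiniteDimensional k W]
    (hstable : ∀ i, ∀ v ∈ W, f i v ∈ W) (v : M) (hv : v ∈ W) (hv0 : π v ≠ 0)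
    (hva : ∀ i, g i (π v) = a i • π v) : ∃ w, w ≠ 0 ∧ ∀ i, f i w = a i • w := by
  -- A minimal stable subspace that lies over the line of `π v` and still reaches `π v` will be a
  -- generalized eigenspace for `a`.
  let P : Submodule k M → Prop := fun U => U ≤ W ⊓ (k ∙ π v).comap π ∧ π v ∈ U.map π ∧
    ∀ i, ∀ v ∈ U, f i v ∈ U
  have hP0 : P (W ⊓ (k ∙ π v).comap π) := by
    refine ⟨le_rfl, ⟨v, ⟨hv, Submodule.mem_span_singleton_self _⟩, rfl⟩, ?_⟩
    rintro i w ⟨hw, hw'⟩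
    refine ⟨hstable i w hw, ?_⟩
    obtain ⟨c, hc⟩ := Submodule.mem_span_singleton.1 (Submodule.mem_comap.1 hw')
    refine Submodule.mem_comap.2 (Submodule.mem_span_singleton.2 ⟨c * a i, ?_⟩)
    rw [hπ, ← hc, map_smul, hva, smul_smul]
  obtain ⟨U, ⟨hUW, hUv, hUs⟩, hmin⟩ :
      ∃ U, P U ∧ ∀ V, P V → V ≤ U → Module.finrank k U ≤ Module.finrank k V := by
    have hne : ∃ n, ∃ U, P U ∧ Module.finrank k U = n := ⟨_, _, hP0, rfl⟩
    classical
    obtain ⟨U, hU, hn⟩ := Nat.find_spec hne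
    exact ⟨U, hU, fun V hV _ => hn.trans_le (Nat.find_min' hne ⟨V, hV, rfl⟩)⟩
  have hUfin : FiniteDimensional k U := Submodule.finiteDimensional_of_le (hUW.trans inf_le_left)
  let h : ι → Module.End k M := fun i => f i - a i • 1
  have hh : ∀ i w, h i w = f i w - a i • w := fun i w => rfl
  have hhcomm : ∀ i j w, h i (h j w) = h j (h i w) := by
    intro i j w
    simp only [hh, map_sub, map_smul, hcomm i j, smul_sub, smul_smul, mul_comm (a i)]
    abel
  have hhU : ∀ i, ∀ w ∈ U, h i w ∈ U := fun i w hw =>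
    U.sub_mem (hUs i w hw) (U.smul_mem _ hw)
  have hhπ : ∀ i, ∀ w ∈ U, π (h i w) = 0 := by
    intro i w hw
    obtain ⟨c, hc⟩ := Submodule.mem_span_singleton.1 (Submodule.mem_comap.1 (hUW hw).2)
    rw [hh, map_sub, hπ, map_smul, ← hc, map_smul, hva, smul_comm, sub_self]
  have hU0 : U ≠ ⊥ := by
    rintro rfl
    obtain ⟨w, hw, hw'⟩ := hUv
    rw [(Submodule.mem_bot k).1 hw, map_zero] at hw'
    exact hv0 hw'.symm
  obtain ⟨w, -, hw0, hw⟩ := exists_forall_apply_eq_zero h hhcomm U hU0 hhU (by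
    intro i
    let e : Module.End k U := (h i).restrict (hhU i)
    have he : ∀ (n : ℕ) (x : U), ((e ^ n) x : M) = (h i ^ n) x := by
      intro n x
      induction n generalizing x with
      | zero => rfl
      | succ n ih => rw [pow_succ, pow_succ, Module.End.mul_apply, Module.End.mul_apply, ih]; rfl
    -- Fitting decomposition of `U` under `h i = f i - a i`. As `n ≥ 1`, the range of `e ^ n` is
    -- killed by `π`, so the kernel still reaches `π v`; by minimality it is `U`, and `h i` is
    -- nilpotent there.
    obtain ⟨n, hn, hn1⟩ := (e.eventually_codisjoint_ker_pow_range_pow.and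
      (Filter.eventually_ge_atTop 1)).exists
    have hK : P ((LinearMap.ker (e ^ n)).map U.subtype) := by
      refine ⟨(Submodule.map_subtype_le _ _).trans hUW, ?_, ?_⟩
      · obtain ⟨x, hx, hxv⟩ := hUv
        obtain ⟨y, hy, z, hz, hyz⟩ := Submodule.mem_sup.1
          (show (⟨x, hx⟩ : U) ∈ LinearMap.ker (e ^ n) ⊔ LinearMap.range (e ^ n) by
            rw [hn.eq_top]; trivial)
        refine ⟨y, ⟨y, hy, rfl⟩, ?_⟩
        have hz0 : π (z : M) = 0 := by
          obtain ⟨z', rfl⟩ := hz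
          obtain ⟨m, rfl⟩ := Nat.exists_eq_add_of_le' hn1
          rw [pow_succ', Module.End.mul_apply]
          exact hhπ i _ (((e ^ m) z').2)
        have hx' : x = y + z := (congrArg Subtype.val hyz).symm
        rw [← hxv, hx', map_add, hz0, add_zero]
      · rintro j _ ⟨y, hy, rfl⟩
        refine ⟨⟨f j y, hUs j _ y.2⟩, ?_, rfl⟩
        rw [SetLike.mem_coe, LinearMap.mem_ker] at hy ⊢
        apply Subtype.ext
        rw [he]
        have hc : Commute (h i) (f j) := by
          refine LinearMap.ext fun w => ?_
          rw [Module.End.mul_apply, Module.End.mul_apply, hh, hh, map_sub, map_smul, hcomm]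
        have h1 : (h i ^ n) (f j y) = f j ((h i ^ n) y) := LinearMap.congr_fun (hc.pow_left n).eq _
        change (h i ^ n) (f j y) = 0
        rw [h1, ← he, hy]
        exact map_zero _
    have hKU : (LinearMap.ker (e ^ n)).map U.subtype = U :=
      Submodule.eq_of_le_of_finrank_le (Submodule.map_subtype_le _ _)
        (hmin _ hK (Submodule.map_subtype_le _ _))
    intro w hw
    rw [← hKU] at hw
    obtain ⟨y, hy, rfl⟩ := hw
    refine ⟨n, ?_⟩
    rw [SetLike.mem_coe, LinearMap.mem_ker] at hy
    change (h i ^ n) (y : M) = 0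
    rw [← he, hy]
    rfl)
  exact ⟨w, hw0, fun i => sub_eq_zero.1 (hw i)⟩

/-- Choose `i` with `a i ≠ χ j i`. Applying `f i - χ j i` to the sum removes `x j`, rescales the
other eigenvectors, and multiplies the whole sum by a nonzero scalar; induction applies to the
rescaled vectors. The `χ j` may coincide. -/
theorem eq_zero_of_eigenvector_sum {J : Type*} (f : ι → Module.End k M) (χ : J → ι → k)
    (a : ι → k) (S : Finset J) (hS : ∀ j ∈ S, a ≠ χ j) :
    ∀ (x : J → M), (∀ j ∈ S, ∀ i, f i (x j) = χ j i • x j) →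
      (∀ i, f i (∑ j ∈ S, x j) = a i • ∑ j ∈ S, x j) → ∑ j ∈ S, x j = 0 := by
  classical
  induction S using Finset.induction_on with
  | empty => simp
  | insert j S hj ih =>
    intro x hx hsum
    obtain ⟨i, hi⟩ := Function.ne_iff.1 (hS j (Finset.mem_insert_self j S))
    have h1 : ∑ l ∈ S, (χ l i - χ j i) • x l = (a i - χ j i) • ∑ l ∈ insert j S, x l := by
      rw [sub_smul, ← hsum i, map_sum, Finset.smul_sum, ← Finset.sum_sub_distrib,
        Finset.sum_insert hj, hx j (Finset.mem_insert_self j S), sub_self, zero_add]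
      refine Finset.sum_congr rfl fun l hl => ?_
      rw [hx l (Finset.mem_insert_of_mem hl), sub_smul]
    have h2 := ih (fun l hl => hS l (Finset.mem_insert_of_mem hl))
      (fun l => (χ l i - χ j i) • x l)
      (fun l hl m => by rw [map_smul, hx l (Finset.mem_insert_of_mem hl), smul_comm])
      (fun m => by rw [h1, map_smul, hsum m, smul_comm])
    rw [h1] at h2
    exact (smul_eq_zero.1 h2).resolve_left (sub_ne_zero.2 hi)

/-- If a sum of eigenvectors of a family of operators is a nonzero eigenvector, then its system of
eigenvalues is that of one of the summands. -/
theorem exists_eq_of_eigenvector_sum {J : Type*} (f : ι → Module.End k M) (χ : J → ι → k)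
    (a : ι → k) (S : Finset J) (x : J → M) (hx : ∀ j ∈ S, ∀ i, f i (x j) = χ j i • x j)
    (hsum : ∀ i, f i (∑ j ∈ S, x j) = a i • ∑ j ∈ S, x j) (h0 : ∑ j ∈ S, x j ≠ 0) :
    ∃ j ∈ S, a = χ j := by
  by_contra! h
  exact h0 (eq_zero_of_eigenvector_sum f χ a S h x hx hsum)

end CommutingFamilies

/-! ### Diagonal representatives of `Γ₀(N)`-double cosets. -/

section Diagonalization

theorem mem_gamma0Row_iff {N : ℕ} {g : SL(2, ℤ)} : g ∈ Gamma0Row N ↔ (N : ℤ) ∣ g 0 1 := Iff.rfl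

/-- The matrix with rows `(a, b)`, `(c, d)` and determinant one. -/
def slOf (a b c d : ℤ) (h : a * d - b * c = 1) : SL(2, ℤ) :=
  ⟨!![a, b; c, d], by rw [Matrix.det_fin_two_of]; exact h⟩

theorem matrix_fin_two_congr {R : Type*} {a b c d a' b' c' d' : R} (ha : a = a') (hb : b = b')
    (hc : c = c') (hd : d = d') : !![a, b; c, d] = !![a', b'; c', d'] := by
  rw [ha, hb, hc, hd]

/-- `Γ₀(N) m Γ₀(N)` contains a diagonal matrix. -/
def HasDiagonalForm (N : ℕ) (m : Matrix (Fin 2) (Fin 2) ℤ) : Prop :=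
  ∃ γ ∈ Gamma0Row N, ∃ δ ∈ Gamma0Row N, ∃ a d : ℤ, γ.1 * m * δ.1 = !![a, 0; 0, d]

theorem HasDiagonalForm.of_mul_left {N : ℕ} {m : Matrix (Fin 2) (Fin 2) ℤ} {γ : SL(2, ℤ)}
    (hγ : γ ∈ Gamma0Row N) (h : HasDiagonalForm N (γ.1 * m)) : HasDiagonalForm N m := by
  obtain ⟨γ', hγ', δ, hδ, a, d, h⟩ := h
  refine ⟨γ' * γ, mul_mem hγ' hγ, δ, hδ, a, d, ?_⟩
  rw [← h, Matrix.SpecialLinearGroup.coe_mul]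
  simp only [Matrix.mul_assoc]

theorem HasDiagonalForm.of_mul_right {N : ℕ} {m : Matrix (Fin 2) (Fin 2) ℤ} {δ : SL(2, ℤ)}
    (hδ : δ ∈ Gamma0Row N) (h : HasDiagonalForm N (m * δ.1)) : HasDiagonalForm N m := by
  obtain ⟨γ, hγ, δ', hδ', a, d, h⟩ := h
  refine ⟨γ, hγ, δ * δ', mul_mem hδ hδ', a, d, ?_⟩
  rw [← h, Matrix.SpecialLinearGroup.coe_mul]
  simp only [Matrix.mul_assoc]

/-- Here `n = gcd(a, b)`. The cofactor `a'` is prime to `b'` and to `N`, hence to `N b'`; the Bézout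
relation supplies the determinant-one matrices, lying in `Γ₀(N)`, used for elimination. -/
theorem exists_coprime_factors {N : ℕ} {a b : ℤ} (h0 : a ≠ 0 ∨ b ≠ 0) (hN : IsCoprime a (N : ℤ)) :
    ∃ (n : ℕ) (a' b' u v : ℤ), 0 < n ∧ a = n * a' ∧ b = n * b' ∧ u * a' + v * (N * b') = 1 := by
  have hg : 0 < Int.gcd a b := Nat.pos_of_ne_zero fun h => by
    rw [Int.gcd_eq_zero_iff] at h
    tauto
  obtain ⟨a', ha'⟩ := Int.gcd_dvd_left a b
  obtain ⟨b', hb'⟩ := Int.gcd_dvd_right a b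
  have hab : IsCoprime a' b' := by
    refine ⟨Int.gcdA a b, Int.gcdB a b, ?_⟩
    have h1 := Int.gcd_eq_gcd_ab a b
    have h2 : (Int.gcd a b : ℤ) * (Int.gcdA a b * a' + Int.gcdB a b * b')
        = (Int.gcd a b : ℤ) * 1 := by
      linear_combination -h1 - Int.gcdA a b * ha' - Int.gcdB a b * hb'
    exact mul_left_cancel₀ (by exact_mod_cast hg.ne') h2
  have haN : IsCoprime a' (N : ℤ) := by
    rw [ha'] at hN
    exact hN.of_mul_left_right
  obtain ⟨u, v, huv⟩ := haN.mul_right hab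
  exact ⟨_, a', b', u, v, hg, ha', hb', huv⟩

theorem exists_mul_right_eq_lower {N : ℕ} {a b : ℤ} (c d : ℤ) (h0 : a ≠ 0 ∨ b ≠ 0)
    (hN : IsCoprime a (N : ℤ)) : ∃ δ ∈ Gamma0Row N, ∃ (n : ℕ) (c' d' : ℤ), 0 < n ∧ (n : ℤ) ∣ a ∧
      !![a, N * b; c, d] * δ.1 = !![(n : ℤ), 0; c', d'] := by
  obtain ⟨n, a', b', u, v, hn, ha, hb, huv⟩ := exists_coprime_factors h0 hN
  refine ⟨slOf u (-(N * b')) v a' (by linear_combination huv), ?_, n, c * u + d * v,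
    c * -(N * b') + d * a', hn, ⟨a', ha⟩, ?_⟩
  · exact (dvd_neg (α := ℤ)).2 (dvd_mul_right _ _)
  · simp only [slOf, Matrix.mul_fin_two]
    refine matrix_fin_two_congr ?_ ?_ rfl rfl
    · rw [ha, hb]; linear_combination (n : ℤ) * huv
    · rw [ha, hb]; ring

/-- Euclidean descent on the upper left entry. If `n ∣ c`, a row operation clears `c`. Otherwise a
row operation replaces `n` by `gcd(n, c) < n` and creates an upper right entry divisible by `N`,
which `exists_mul_right_eq_lower` removes without enlarging the corner. -/
theorem hasDiagonalForm_lower {N : ℕ} (n : ℕ) (hn : 0 < n) (hN : IsCoprime (n : ℤ) (N : ℤ)) :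
    ∀ c d : ℤ, HasDiagonalForm N !![(n : ℤ), 0; c, d] := by
  induction n using Nat.strong_induction_on with
  | _ n ih =>
    intro c d
    by_cases hc : (n : ℤ) ∣ c
    · obtain ⟨e, he⟩ := hc
      refine HasDiagonalForm.of_mul_left (γ := slOf 1 0 (-e) 1 (by ring)) (dvd_zero _)
        ⟨1, one_mem _, 1, one_mem _, n, d, ?_⟩
      simp only [slOf, Matrix.mul_fin_two, Matrix.SpecialLinearGroup.coe_one, one_mul, mul_one]
      refine matrix_fin_two_congr ?_ ?_ ?_ ?_
      · ring
      · ring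
      · rw [he]; ring
      · ring
    · obtain ⟨h, n', c', u, v, hh, hn', hc', huv⟩ := exists_coprime_factors (b := c)
        (Or.inl (by exact_mod_cast hn.ne')) hN
      have hhn : h < n := by
        refine lt_of_le_of_ne (Nat.le_of_dvd hn (by exact_mod_cast Dvd.intro _ hn'.symm)) ?_
        rintro rfl
        exact hc ⟨c', hc'⟩
      have hhN : IsCoprime (h : ℤ) (N : ℤ) := by
        rw [hn'] at hN
        exact hN.of_mul_left_left
      refine HasDiagonalForm.of_mul_left (γ := slOf u (N * v) (-c') n' (by linear_combination huv))
        (dvd_mul_right _ _) ?_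
      have hm : (slOf u (N * v) (-c') n' (by linear_combination huv)).1 * !![(n : ℤ), 0; c, d]
          = !![(h : ℤ), N * (v * d); 0, n' * d] := by
        simp only [slOf, Matrix.mul_fin_two]
        refine matrix_fin_two_congr ?_ ?_ ?_ ?_
        · rw [hn', hc']; linear_combination (h : ℤ) * huv
        · ring
        · rw [hn', hc']; ring
        · ring
      rw [hm]
      obtain ⟨δ, hδ, n₁, c₁, d₁, hn₁, hdvd, heq⟩ := exists_mul_right_eq_lower 0 (n' * d) (b := v * d)
        (Or.inl (by exact_mod_cast hh.ne')) hhN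
      refine HasDiagonalForm.of_mul_right hδ ?_
      rw [heq]
      have hdvd' : n₁ ∣ h := by exact_mod_cast hdvd
      exact ih n₁ ((Nat.le_of_dvd hh hdvd').trans_lt hhn) hn₁ (hhN.of_isCoprime_of_dvd_left hdvd) _ _

theorem hasDiagonalForm {N : ℕ} (m : Matrix (Fin 2) (Fin 2) ℤ) (h01 : (N : ℤ) ∣ m 0 1)
    (hdet : m.det ≠ 0) (hN : IsCoprime m.det (N : ℤ)) : HasDiagonalForm N m := by
  obtain ⟨b, hb⟩ := h01
  rw [Matrix.det_fin_two, hb] at hdet hN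
  have ha : IsCoprime (m 0 0) (N : ℤ) := by
    obtain ⟨u, v, huv⟩ := hN
    exact ⟨u * m 1 1, v - u * b * m 1 0, by linear_combination huv⟩
  have h0 : m 0 0 ≠ 0 ∨ b ≠ 0 := by
    by_contra! h
    exact hdet (by rw [h.1, h.2]; ring)
  obtain ⟨δ, hδ, n, c, d, hn, hdvd, heq⟩ := exists_mul_right_eq_lower (m 1 0) (m 1 1) h0 ha
  refine HasDiagonalForm.of_mul_right hδ ?_
  rw [Matrix.eta_fin_two m, hb, heq]
  exact hasDiagonalForm_lower n hn (ha.of_isCoprime_of_dvd_left hdvd) _ _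

end Diagonalization

/-! ### The anti-involution of `GL₂(ℚ)` attached to `Γ₀(N)`. -/

section Involution

/-- The anti-automorphism `g ↦ D gᵀ D⁻¹` of `GL₂(ℚ)`, where `D = diag(N, 1)`. -/
def transposeConj (N : ℕ) [NeZero N] (g : GL (Fin 2) ℚ) : GL (Fin 2) ℚ where
  val := !![(N : ℚ), 0; 0, 1] * g.1.transpose * !![(N : ℚ)⁻¹, 0; 0, 1]
  inv := !![(N : ℚ), 0; 0, 1] * (g⁻¹).1.transpose * !![(N : ℚ)⁻¹, 0; 0, 1]
  val_inv := by
    have h : !![(N : ℚ)⁻¹, 0; 0, 1] * !![(N : ℚ), 0; 0, 1] = 1 := by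
      simp [Matrix.one_fin_two, NeZero.ne]
    have h' : !![(N : ℚ), 0; 0, 1] * !![(N : ℚ)⁻¹, 0; 0, 1] = 1 := by
      simp [Matrix.one_fin_two, NeZero.ne]
    rw [show ∀ a b c d e : Matrix (Fin 2) (Fin 2) ℚ, a * b * c * (a * d * e)
      = a * b * (c * a) * d * e from fun a b c d e => by simp only [Matrix.mul_assoc], h,
      mul_one, Matrix.mul_assoc _ g.1.transpose, ← Matrix.transpose_mul]
    simp [h']
  inv_val := by
    have h : !![(N : ℚ)⁻¹, 0; 0, 1] * !![(N : ℚ), 0; 0, 1] = 1 := by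
      simp [Matrix.one_fin_two, NeZero.ne]
    have h' : !![(N : ℚ), 0; 0, 1] * !![(N : ℚ)⁻¹, 0; 0, 1] = 1 := by
      simp [Matrix.one_fin_two, NeZero.ne]
    rw [show ∀ a b c d e : Matrix (Fin 2) (Fin 2) ℚ, a * b * c * (a * d * e)
      = a * b * (c * a) * d * e from fun a b c d e => by simp only [Matrix.mul_assoc], h,
      mul_one, Matrix.mul_assoc _ (g⁻¹).1.transpose, ← Matrix.transpose_mul]
    simp [h']

variable {N : ℕ} [NeZero N]

theorem transposeConj_val (g : GL (Fin 2) ℚ) :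
    (transposeConj N g).1 = !![g.1 0 0, N * g.1 1 0; (N : ℚ)⁻¹ * g.1 0 1, g.1 1 1] := by
  have hN : (N : ℚ) ≠ 0 := NeZero.ne _
  change !![(N : ℚ), 0; 0, 1] * g.1.transpose * !![(N : ℚ)⁻¹, 0; 0, 1] = _
  rw [Matrix.eta_fin_two g.1.transpose]
  simp only [Matrix.mul_fin_two, Matrix.transpose_apply]
  refine matrix_fin_two_congr ?_ ?_ ?_ ?_ <;> field_simp <;> ring

theorem transposeConj_mul (g h : GL (Fin 2) ℚ) :
    transposeConj N (g * h) = transposeConj N h * transposeConj N g := by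
  have hN : (N : ℚ) ≠ 0 := NeZero.ne _
  apply Units.ext
  rw [Units.val_mul, transposeConj_val, transposeConj_val, transposeConj_val, Units.val_mul,
    Matrix.mul_fin_two]
  simp only [Matrix.mul_apply, Fin.sum_univ_two]
  refine matrix_fin_two_congr ?_ ?_ ?_ ?_ <;> field_simp

theorem transposeConj_transposeConj (g : GL (Fin 2) ℚ) :
    transposeConj N (transposeConj N g) = g := by
  have hN : (N : ℚ) ≠ 0 := NeZero.ne _
  apply Units.ext
  rw [transposeConj_val, transposeConj_val]
  conv_rhs => rw [Matrix.eta_fin_two g.1]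
  simp [hN]

theorem transposeConj_mem {g : GL (Fin 2) ℚ} (hg : g ∈ Gamma0Q N) :
    transposeConj N g ∈ Gamma0Q N := by
  obtain ⟨γ, hγ, rfl⟩ := hg
  obtain ⟨b, hb⟩ := mem_gamma0Row_iff.1 hγ
  have hN : (N : ℚ) ≠ 0 := NeZero.ne _
  have hdet := γ.2
  rw [Matrix.det_fin_two] at hdet
  change γ 0 0 * γ 1 1 - γ 0 1 * γ 1 0 = 1 at hdet
  refine ⟨slOf (γ 0 0) (N * γ 1 0) b (γ 1 1) ?_, dvd_mul_right _ _, ?_⟩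
  · rw [hb] at hdet
    linear_combination hdet
  · apply Units.ext
    rw [transposeConj_val]
    refine (Matrix.eta_fin_two _).trans (matrix_fin_two_congr rfl ?_ ?_ rfl)
    · change ((N * γ 1 0 : ℤ) : ℚ) = N * ((γ 1 0 : ℤ) : ℚ)
      push_cast
      rfl
    · change (b : ℚ) = (N : ℚ)⁻¹ * ((γ 0 1 : ℤ) : ℚ)
      rw [hb]
      push_cast
      field_simp

/-- Diagonal matrices are fixed by the anti-involution, and each double coset `Γ s Γ` with `s ∈ Δ`
contains one. -/
theorem isDoubleCosetInvolution_transposeConj (p : ℕ) :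
    HeckeH1.IsDoubleCosetInvolution (heckeSemigroup p N) (Gamma0Q N) (transposeConj N) where
  map_mul := transposeConj_mul
  map_mem_iff g := ⟨fun h => transposeConj_transposeConj (N := N) g ▸ transposeConj_mem h,
    transposeConj_mem⟩
  inDoubleCoset s hs := by
    obtain ⟨m, hm, h01, hdet, hcop⟩ := hs
    have hN : IsCoprime m.det (N : ℤ) := by
      push_cast at hcop
      exact hcop.of_mul_right_right
    obtain ⟨γ, hγ, δ, hδ, a, d, h⟩ := hasDiagonalForm m h01 hdet.ne' hN
    let γ' := Matrix.SpecialLinearGroup.mapGL ℚ γ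
    let δ' := Matrix.SpecialLinearGroup.mapGL ℚ δ
    have hγ' : γ' ∈ Gamma0Q N := ⟨γ, hγ, rfl⟩
    have hδ' : δ' ∈ Gamma0Q N := ⟨δ, hδ, rfl⟩
    have hval : (γ' * s * δ').1 = !![(a : ℚ), 0; 0, (d : ℚ)] := by
      rw [Units.val_mul, Units.val_mul, ← hm]
      change (Int.castRingHom ℚ).mapMatrix γ.1 * (Int.castRingHom ℚ).mapMatrix m
        * (Int.castRingHom ℚ).mapMatrix δ.1 = _
      rw [← map_mul, ← map_mul, h]
      ext i j
      fin_cases i <;> fin_cases j <;> simp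
    have hfix : transposeConj N (γ' * s * δ') = γ' * s * δ' := by
      apply Units.ext
      rw [transposeConj_val, hval]
      simp
    rw [transposeConj_mul, transposeConj_mul] at hfix
    refine ⟨(transposeConj N δ')⁻¹ * γ', mul_mem (inv_mem (transposeConj_mem hδ')) hγ',
      δ' * (transposeConj N γ')⁻¹, mul_mem hδ' (inv_mem (transposeConj_mem hγ')), ?_⟩
    have h2 : transposeConj N s
        = (transposeConj N δ')⁻¹ * (γ' * s * δ') * (transposeConj N γ')⁻¹ := by
      rw [← hfix]; group
    rw [h2]
    group

end Involution

/-! ### Strong approximation for `SL₂(ℤ)`. -/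

section StrongApproximation

/-- Take for `t` the product of the primes dividing `c` but not `d`. A prime divisor of `c` then
divides exactly one of `d` and `t * M`. -/
theorem exists_isCoprime_add_mul {c d : ℤ} {M : ℕ} (hc : c ≠ 0)
    (h : ∀ q : ℕ, q.Prime → (q : ℤ) ∣ c → (q : ℤ) ∣ d → ¬ q ∣ M) :
    ∃ t : ℤ, IsCoprime c (d + t * M) := by
  let ps : Finset ℕ := {q ∈ c.natAbs.primeFactors | ¬ (q : ℤ) ∣ d}
  refine ⟨((ps.prod id : ℕ) : ℤ), ?_⟩
  rw [Int.isCoprime_iff_gcd_eq_one]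
  refine Nat.coprime_of_dvd fun q hq hqc hqd => ?_
  have hqc' : (q : ℤ) ∣ c := Int.natCast_dvd.2 hqc
  have hqd' : (q : ℤ) ∣ d + ((ps.prod id : ℕ) : ℤ) * M := Int.natCast_dvd.2 hqd
  by_cases hqd0 : (q : ℤ) ∣ d
  · have h1 : (q : ℤ) ∣ ((ps.prod id * M : ℕ) : ℤ) := by
      push_cast
      exact (dvd_add_right hqd0).1 (by simpa using hqd')
    rw [Int.natCast_dvd_natCast, hq.dvd_mul] at h1
    rcases h1 with h1 | h1
    · obtain ⟨q', hq', hqq'⟩ := (hq.prime.dvd_finsetProd_iff id).1 h1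
      rw [Finset.mem_filter, Nat.mem_primeFactors, ← (Nat.prime_dvd_prime_iff_eq hq hq'.1.1).1 hqq'] at hq'
      exact hq'.2 hqd0
    · exact h q hq hqc' hqd0 h1
  · have hmem : q ∈ ps := Finset.mem_filter.2
      ⟨Nat.mem_primeFactors.2 ⟨hq, hqc, Int.natAbs_ne_zero.2 hc⟩, hqd0⟩
    have h1 : (q : ℤ) ∣ ((ps.prod id : ℕ) : ℤ) :=
      Int.natCast_dvd_natCast.2 (Finset.dvd_prod_of_mem id hmem)
    exact hqd0 ((dvd_add_left (h1.mul_right _)).1 hqd')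

/-- Reduction `SL₂(ℤ) → SL₂(ℤ/M)` is surjective. -/
theorem exists_sl_congr {M : ℕ} (hM : M ≠ 0) (m : Matrix (Fin 2) (Fin 2) ℤ)
    (hm : (M : ℤ) ∣ m.det - 1) : ∃ g : SL(2, ℤ), ∀ i j, (M : ℤ) ∣ g i j - m i j := by
  rw [Matrix.det_fin_two] at hm
  obtain ⟨c, hc0, r, hc⟩ : ∃ c : ℤ, c ≠ 0 ∧ ∃ r : ℤ, c = m 1 0 + r * M := by
    by_cases h : m 1 0 = 0
    · exact ⟨M, by exact_mod_cast hM, 1, by rw [h]; ring⟩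
    · exact ⟨_, h, 0, by ring⟩
  obtain ⟨k, hk⟩ := hm
  have hgcd : ∀ q : ℕ, q.Prime → (q : ℤ) ∣ c → (q : ℤ) ∣ m 1 1 → ¬ q ∣ M := by
    intro q hq h1 h2 h3
    have h3' : (q : ℤ) ∣ (M : ℤ) := Int.natCast_dvd_natCast.2 h3
    have h4 : (q : ℤ) ∣ 1 := by
      have : (1 : ℤ) = m 0 0 * m 1 1 - m 0 1 * c + (M : ℤ) * (m 0 1 * r - k) := by
        rw [hc]; linear_combination -hk
      rw [this]
      exact dvd_add (dvd_sub (h2.mul_left _) (h1.mul_left _)) (h3'.mul_right _)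
    have h5 : q ∣ 1 := by exact_mod_cast h4
    exact hq.one_lt.ne' (Nat.dvd_one.1 h5)
  obtain ⟨t, u, v, huv⟩ := exists_isCoprime_add_mul hc0 hgcd
  obtain ⟨l, hl⟩ : ∃ l : ℤ, m 0 0 * (m 1 1 + t * M) - m 0 1 * c = 1 + l * M :=
    ⟨k + m 0 0 * t - m 0 1 * r, by rw [hc]; linear_combination hk⟩
  -- The bottom row is now coprime and the determinant is `1 + l * M`; the Bézout coefficients `u`,
  -- `v` of that row correct the top row by multiples of `M`.
  refine ⟨slOf (m 0 0 - l * v * M) (m 0 1 + l * u * M) c (m 1 1 + t * M)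
    (by linear_combination hl - l * M * huv), fun i j => ?_⟩
  fin_cases i <;> fin_cases j
  · exact ⟨-(l * v), by change m 0 0 - l * v * M - m 0 0 = _; ring⟩
  · exact ⟨l * u, by change m 0 1 + l * u * M - m 0 1 = _; ring⟩
  · exact ⟨r, by change c - m 1 0 = _; rw [hc]; ring⟩
  · exact ⟨t, by change m 1 1 + t * M - m 1 1 = _; ring⟩

end StrongApproximation

/-! ### Reduction of the Hecke semigroup modulo `p`. -/

section Reduction

variable {p N : ℕ}

theorem reduction_val_apply (F : Type*) [Field F] [CharP F p] (s : heckeSemigroup p N)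
    (i j : Fin 2) : (reduction p N F s).1 i j = ((intMatrix s i j : ℤ) : F) := rfl

theorem intMatrix_mul (s t : heckeSemigroup p N) :
    intMatrix (s * t) = intMatrix s * intMatrix t := by
  apply intMatrix_eq
  rw [map_mul, (intMatrix_spec s).1, (intMatrix_spec t).1]
  rfl

theorem intMatrix_incl [NeZero N] (γ : SL(2, ℤ)) (hγ : γ ∈ Gamma0Row N) :
    intMatrix (HeckeH1.incl (heckeSemigroup p N) (Gamma0Q N) ⟨_, γ, hγ, rfl⟩) = γ.1 :=
  intMatrix_eq _ _ rfl

theorem det_intMatrix_incl [NeZero N] (γ : Gamma0Q N) :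
    (intMatrix (HeckeH1.incl (heckeSemigroup p N) (Gamma0Q N) γ)).det = 1 := by
  obtain ⟨_, γ, hγ, rfl⟩ := γ
  rw [intMatrix_incl γ hγ, γ.2]

/-- Two elements of the Hecke semigroup with congruent determinants have the same reduction up to
an element of `Γ₀(N)`. -/
theorem exists_reduction_eq_mul [NeZero p] [NeZero N] (F : Type*) [Field F] [CharP F p]
    (s t : heckeSemigroup p N) (h : (p : ℤ) ∣ (intMatrix s).det - (intMatrix t).det) :
    ∃ γ : Gamma0Q N, reduction p N F s
      = reduction p N F t * reduction p N F (HeckeH1.incl _ _ γ) := by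
  obtain ⟨-, hs, -, r, w', hr⟩ := intMatrix_spec s
  obtain ⟨-, ht, -, n', w, hn⟩ := intMatrix_spec t
  have hdetT := Matrix.det_fin_two (intMatrix t)
  have hdetS := Matrix.det_fin_two (intMatrix s)
  set S := intMatrix s with hS
  set T := intMatrix t with hT
  obtain ⟨l, hl⟩ := h
  obtain ⟨e, he⟩ : ∃ e, e = T.det * r := ⟨_, rfl⟩
  -- The matrix is `n' · adj(T) · S`, that is `T⁻¹ S` modulo `p N`, with its second column
  -- multiplied by `e ≡ det T / det S`. This makes the determinant 1 modulo `p N`, and `e ≡ 1`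
  -- modulo `p` leaves the reduction unchanged.
  obtain ⟨γ, hγ⟩ := exists_sl_congr (M := p * N) (mul_ne_zero (NeZero.ne p) (NeZero.ne N))
    !![n' * (T 1 1 * S 0 0 - T 0 1 * S 1 0), e * n' * (T 1 1 * S 0 1 - T 0 1 * S 1 1);
      n' * (T 0 0 * S 1 0 - T 1 0 * S 0 0), e * n' * (T 0 0 * S 1 1 - T 1 0 * S 0 1)] (by
      refine ⟨-2 * w + w ^ 2 * (p * N : ℕ) - w' * (1 - w * (p * N : ℕ)) ^ 2, ?_⟩
      have h1 : n' ^ 2 * e * T.det * S.det = (n' * T.det) ^ 2 * (r * S.det) := by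
        rw [he]; ring
      rw [eq_sub_of_add_eq hn, eq_sub_of_add_eq hr, hdetT, hdetS] at h1
      rw [Matrix.det_fin_two_of]
      linear_combination h1)
  have hγ01 : γ ∈ Gamma0Row N := by
    have h1 : (N : ℤ) ∣ γ 0 1 - e * n' * (T 1 1 * S 0 1 - T 0 1 * S 1 1) :=
      (Int.natCast_dvd_natCast.2 (dvd_mul_left N p)).trans (hγ 0 1)
    have h2 : (N : ℤ) ∣ e * n' * (T 1 1 * S 0 1 - T 0 1 * S 1 1) :=
      (dvd_sub (hs.mul_left _) (ht.mul_right _)).mul_left _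
    exact (dvd_iff_dvd_of_dvd_sub h1).2 h2
  have hp : (p : F) = 0 := CharP.cast_eq_zero F p
  have hcast : ∀ x y : ℤ, ((p * N : ℕ) : ℤ) ∣ x - y → (x : F) = y := by
    rintro x y ⟨q, hq⟩
    rw [← sub_eq_zero, ← Int.cast_sub, hq]
    push_cast
    rw [hp]
    ring
  have he1 : (e : F) = 1 := by
    have h1 : e = 1 + p * (-w' * N - l * r) := by
      push_cast at hr
      rw [he]; linear_combination hr - r * hl
    rw [h1]
    push_cast
    rw [hp]
    ring
  have hn1 : (n' : F) * (T 0 0 * T 1 1 - T 0 1 * T 1 0) = 1 := by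
    have h1 := congrArg (Int.cast : ℤ → F) hn
    rw [hdetT] at h1
    push_cast at h1
    rw [hp] at h1
    linear_combination h1
  have h00 : ((γ 0 0 : ℤ) : F) = n' * (T 1 1 * S 0 0 - T 0 1 * S 1 0) := by
    have h := hcast (γ 0 0) (n' * (T 1 1 * S 0 0 - T 0 1 * S 1 0)) (hγ 0 0)
    push_cast at h
    exact h
  have h01 : ((γ 0 1 : ℤ) : F) = n' * (T 1 1 * S 0 1 - T 0 1 * S 1 1) := by
    have h := hcast (γ 0 1) (e * n' * (T 1 1 * S 0 1 - T 0 1 * S 1 1)) (hγ 0 1)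
    push_cast at h
    rw [he1, one_mul] at h
    exact h
  have h10 : ((γ 1 0 : ℤ) : F) = n' * (T 0 0 * S 1 0 - T 1 0 * S 0 0) := by
    have h := hcast (γ 1 0) (n' * (T 0 0 * S 1 0 - T 1 0 * S 0 0)) (hγ 1 0)
    push_cast at h
    exact h
  have h11 : ((γ 1 1 : ℤ) : F) = n' * (T 0 0 * S 1 1 - T 1 0 * S 0 1) := by
    have h := hcast (γ 1 1) (e * n' * (T 0 0 * S 1 1 - T 1 0 * S 0 1)) (hγ 1 1)
    push_cast at h
    rw [he1, one_mul] at h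
    exact h
  refine ⟨⟨_, γ, hγ01, rfl⟩, ?_⟩
  rw [← map_mul]
  apply Units.ext
  ext i j
  rw [reduction_val_apply, reduction_val_apply, intMatrix_mul, intMatrix_incl γ hγ01, Matrix.mul_apply,
    Fin.sum_univ_two, ← hS, ← hT]
  push_cast
  fin_cases i <;> fin_cases j
  · change (S 0 0 : F) = T 0 0 * (γ 0 0 : ℤ) + T 0 1 * (γ 1 0 : ℤ)
    rw [h00, h10]
    linear_combination -(S 0 0 : F) * hn1
  · change (S 0 1 : F) = T 0 0 * (γ 0 1 : ℤ) + T 0 1 * (γ 1 1 : ℤ)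
    rw [h01, h11]
    linear_combination -(S 0 1 : F) * hn1
  · change (S 1 0 : F) = T 1 0 * (γ 0 0 : ℤ) + T 1 1 * (γ 1 0 : ℤ)
    rw [h00, h10]
    linear_combination -(S 1 0 : F) * hn1
  · change (S 1 1 : F) = T 1 0 * (γ 0 1 : ℤ) + T 1 1 * (γ 1 1 : ℤ)
    rw [h01, h11]
    linear_combination -(S 1 1 : F) * hn1

theorem exists_det_eq [NeZero p] [NeZero N] (d : (ZMod p)ˣ) :
    ∃ s : heckeSemigroup p N, ((intMatrix s).det : ZMod p) = d := by
  obtain ⟨e, he⟩ := ZMod.unitsMap_surjective (dvd_mul_right p N) d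
  have hpN : p * N ≠ 0 := mul_ne_zero (NeZero.ne p) (NeZero.ne N)
  obtain ⟨n, hn, hn'⟩ : ∃ n : ℕ, 0 < n ∧ (n : ZMod (p * N)) = e := by
    -- The summand `p * N` makes the determinant positive without changing its residue.
    refine ⟨(e : ZMod (p * N)).val + p * N, by positivity, ?_⟩
    push_cast
    rw [ZMod.natCast_zmod_val, ← Nat.cast_mul, ZMod.natCast_self, add_zero]
  have hcop : Nat.Coprime n (p * N) := by
    rw [← ZMod.isUnit_iff_coprime, hn']
    exact e.isUnit
  let g : GL (Fin 2) ℚ := Matrix.GeneralLinearGroup.mkOfDetNeZero !![1, 0; 0, (n : ℚ)]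
    (by simpa using hn.ne')
  have hm : (Int.castRingHom ℚ).mapMatrix !![1, 0; 0, (n : ℤ)] = g.1 := by
    ext i j
    fin_cases i <;> fin_cases j <;> simp [g, Matrix.GeneralLinearGroup.mkOfDetNeZero]
  have hdet : (!![1, 0; 0, (n : ℤ)]).det = n := by simp
  let s : heckeSemigroup p N := ⟨g, _, hm, dvd_zero _, by rw [hdet]; exact_mod_cast hn,
    by rw [hdet]; exact Nat.isCoprime_iff_coprime.2 hcop⟩
  refine ⟨s, ?_⟩
  rw [intMatrix_eq s _ hm, hdet, ← he]
  have h1 := congrArg (ZMod.castHom (dvd_mul_right p N) (ZMod p)) hn'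
  rw [map_natCast] at h1
  rw [Int.cast_natCast, h1]
  rfl

/-- `F` may be infinite, but the reduction only depends on the entries in `𝔽_p`. This makes the
orbits of `Δ` on coefficient modules finite. -/
theorem finite_range_reduction [NeZero p] (N : ℕ) (F : Type*) [Field F] [CharP F p] :
    (Set.range (reduction p N F)).Finite := by
  let h : heckeSemigroup p N → Matrix (Fin 2) (Fin 2) (ZMod p) :=
    fun s => (intMatrix s).map (Int.cast : ℤ → ZMod p)
  have hf : Function.FactorsThrough (reduction p N F) h := by
    intro s t hst
    apply Units.ext
    ext i j
    have h1 : ((intMatrix s i j : ℤ) : ZMod p) = (intMatrix t i j : ℤ) := 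
      congrFun (congrFun hst i) j
    rw [reduction_val_apply, reduction_val_apply, ← sub_eq_zero, ← Int.cast_sub,
      CharP.intCast_eq_zero_iff F p, ← ZMod.intCast_eq_intCast_iff_dvd_sub]
    exact h1.symm
  refine (Set.finite_range (Function.extend h (reduction p N F) 1)).subset ?_
  rintro _ ⟨s, rfl⟩
  exact ⟨h s, hf.extend_apply 1 s⟩

end Reduction

/-! ### The Sanov subgroup: freeness and index. -/

section SanovSubgroup

/-- The generators `(1, 2; 0, 1)` and `(1, 0; 2, 1)` of the Sanov subgroup of `SL₂(ℤ)`. -/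
def sanovGen (b : Bool) : SL(2, ℤ) := bif b then slOf 1 2 0 1 (by ring) else slOf 1 0 2 1 (by ring)

theorem slOf_inv (a b c d : ℤ) (h : a * d - b * c = 1) :
    (slOf a b c d h)⁻¹ = slOf d (-b) (-c) a (by linear_combination h) := by
  apply Subtype.ext
  rw [Matrix.SpecialLinearGroup.SL2_inv_expl]
  rfl

theorem sanovGen_true_eq : sanovGen true = slOf 1 2 0 1 (by ring) := rfl

theorem sanovGen_false_eq : sanovGen false = slOf 1 0 2 1 (by ring) := rfl

theorem sanovGen_true_inv : (sanovGen true)⁻¹ = slOf 1 (-2) (-0) 1 (by ring) :=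
  slOf_inv 1 2 0 1 (by ring)

theorem sanovGen_false_inv : (sanovGen false)⁻¹ = slOf 1 (-0) (-2) 1 (by ring) :=
  slOf_inv 1 0 2 1 (by ring)

theorem sanovGen_true_mul_zero_zero (g : SL(2, ℤ)) :
    (sanovGen true * g) 0 0 = g 0 0 + 2 * g 1 0 := by
  rw [sanovGen_true_eq]
  exact (Matrix.two_mul_expl _ g.1).1.trans (by simp [slOf])

theorem sanovGen_true_mul_zero_one (g : SL(2, ℤ)) :
    (sanovGen true * g) 0 1 = g 0 1 + 2 * g 1 1 := by
  rw [sanovGen_true_eq]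
  exact (Matrix.two_mul_expl _ g.1).2.1.trans (by simp [slOf])

theorem sanovGen_true_mul_one_zero (g : SL(2, ℤ)) :
    (sanovGen true * g) 1 0 = g 1 0 := by
  rw [sanovGen_true_eq]
  exact (Matrix.two_mul_expl _ g.1).2.2.1.trans (by simp [slOf])

theorem sanovGen_false_mul_zero_zero (g : SL(2, ℤ)) :
    (sanovGen false * g) 0 0 = g 0 0 := by
  rw [sanovGen_false_eq]
  exact (Matrix.two_mul_expl _ g.1).1.trans (by simp [slOf])

theorem sanovGen_false_mul_zero_one (g : SL(2, ℤ)) :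
    (sanovGen false * g) 0 1 = g 0 1 := by
  rw [sanovGen_false_eq]
  exact (Matrix.two_mul_expl _ g.1).2.1.trans (by simp [slOf])

theorem sanovGen_false_mul_one_zero (g : SL(2, ℤ)) :
    (sanovGen false * g) 1 0 = 2 * g 0 0 + g 1 0 := by
  rw [sanovGen_false_eq]
  exact (Matrix.two_mul_expl _ g.1).2.2.1.trans (by simp [slOf])

theorem sanovGen_true_inv_mul_zero_zero (g : SL(2, ℤ)) :
    ((sanovGen true)⁻¹ * g) 0 0 = g 0 0 + -(2 * g 1 0) := by
  rw [sanovGen_true_inv]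
  exact (Matrix.two_mul_expl _ g.1).1.trans (by simp [slOf])

theorem sanovGen_true_inv_mul_zero_one (g : SL(2, ℤ)) :
    ((sanovGen true)⁻¹ * g) 0 1 = g 0 1 + -(2 * g 1 1) := by
  rw [sanovGen_true_inv]
  exact (Matrix.two_mul_expl _ g.1).2.1.trans (by simp [slOf])

theorem sanovGen_true_inv_mul_one_zero (g : SL(2, ℤ)) :
    ((sanovGen true)⁻¹ * g) 1 0 = g 1 0 := by
  rw [sanovGen_true_inv]
  exact (Matrix.two_mul_expl _ g.1).2.2.1.trans (by simp [slOf])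

theorem sanovGen_false_inv_mul_zero_zero (g : SL(2, ℤ)) :
    ((sanovGen false)⁻¹ * g) 0 0 = g 0 0 := by
  rw [sanovGen_false_inv]
  exact (Matrix.two_mul_expl _ g.1).1.trans (by simp [slOf])

theorem sanovGen_false_inv_mul_zero_one (g : SL(2, ℤ)) :
    ((sanovGen false)⁻¹ * g) 0 1 = g 0 1 := by
  rw [sanovGen_false_inv]
  exact (Matrix.two_mul_expl _ g.1).2.1.trans (by simp [slOf])

theorem sanovGen_false_inv_mul_one_zero (g : SL(2, ℤ)) :
    ((sanovGen false)⁻¹ * g) 1 0 = -(2 * g 0 0) + g 1 0 := by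
  rw [sanovGen_false_inv]
  exact (Matrix.two_mul_expl _ g.1).2.2.1.trans (by simp [slOf])

theorem sl_col_ne_zero (g : SL(2, ℤ)) : g 0 0 ≠ 0 ∨ g 1 0 ≠ 0 := by
  by_contra! h
  have hdet : g 0 0 * g 1 1 - g 0 1 * g 1 0 = 1 := by rw [← Matrix.det_fin_two]; exact g.2
  rw [h.1, h.2] at hdet
  simp at hdet

/-- Ping-pong on the first column `(x, y)`. The four sets cut the projective line into `x/y ≥ 1` or
`∞`, `0 ≤ x/y < 1`, `x/y < -1` and `-1 ≤ x/y < 0`; multiplying by `y²` avoids division. -/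
theorem injective_lift_sanovGen : Function.Injective (FreeGroup.lift sanovGen) := by
  let X : Bool → Set SL(2, ℤ) := fun b => bif b then
    {g | g 1 0 * g 1 0 ≤ g 0 0 * g 1 0} else {g | 0 ≤ g 0 0 * g 1 0 ∧ g 0 0 * g 1 0 < g 1 0 * g 1 0}
  let Y : Bool → Set SL(2, ℤ) := fun b => bif b then
    {g | g 0 0 * g 1 0 < -(g 1 0 * g 1 0)} else
    {g | -(g 1 0 * g 1 0) ≤ g 0 0 * g 1 0 ∧ g 0 0 * g 1 0 < 0}
  have hXt : ∀ g, g ∈ X true ↔ g 1 0 * g 1 0 ≤ g 0 0 * g 1 0 := fun g => Iff.rfl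
  have hXf : ∀ g, g ∈ X false ↔ 0 ≤ g 0 0 * g 1 0 ∧ g 0 0 * g 1 0 < g 1 0 * g 1 0 :=
    fun g => Iff.rfl
  have hYt : ∀ g, g ∈ Y true ↔ g 0 0 * g 1 0 < -(g 1 0 * g 1 0) := fun g => Iff.rfl
  have hYf : ∀ g, g ∈ Y false ↔ -(g 1 0 * g 1 0) ≤ g 0 0 * g 1 0 ∧ g 0 0 * g 1 0 < 0 :=
    fun g => Iff.rfl
  refine FreeGroup.injective_lift_of_ping_pong sanovGen X Y ?_ ?_ ?_ ?_ ?_ ?_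
  · rintro (_ | _)
    · exact ⟨slOf 0 (-1) 1 0 (by ring), by rw [hXf]; simp [slOf]⟩
    · exact ⟨1, by rw [hXt]; simp⟩
  · rintro (_ | _) (_ | _) hij
    · exact (hij rfl).elim
    · refine Set.disjoint_left.2 fun g h1 h2 => ?_
      rw [hXf] at h1; rw [hXt] at h2; omega
    · refine Set.disjoint_left.2 fun g h1 h2 => ?_
      rw [hXt] at h1; rw [hXf] at h2; omega
    · exact (hij rfl).elim
  · rintro (_ | _) (_ | _) hij
    · exact (hij rfl).elim
    · refine Set.disjoint_left.2 fun g h1 h2 => ?_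
      rw [hYf] at h1; rw [hYt] at h2; omega
    · refine Set.disjoint_left.2 fun g h1 h2 => ?_
      rw [hYt] at h1; rw [hYf] at h2; omega
    · exact (hij rfl).elim
  · rintro (_ | _) (_ | _) <;> refine Set.disjoint_left.2 fun g h1 h2 => ?_ <;>
      have h3 := mul_self_nonneg (g 1 0)
    · rw [hXf] at h1; rw [hYf] at h2; omega
    · rw [hXf] at h1; rw [hYt] at h2; omega
    · rw [hXt] at h1; rw [hYf] at h2; omega
    · rw [hXt] at h1; rw [hYt] at h2; omega
  · rintro (_ | _)
    · rintro _ ⟨g, hg, rfl⟩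
      rw [Set.mem_compl_iff, hYf] at hg
      change sanovGen false * g ∈ X false
      rw [hXf, sanovGen_false_mul_zero_zero, sanovGen_false_mul_one_zero]
      have h0 := sl_col_ne_zero g
      generalize g 0 0 = x at *
      generalize g 1 0 = y at *
      have hx := mul_self_nonneg x
      have hy := mul_self_nonneg y
      rcases le_or_gt 0 (x * y) with h | h
      · have hpos : 0 < x * x + y * y := by
          rcases h0 with h0 | h0
          · have := mul_self_pos.2 h0; omega
          · have := mul_self_pos.2 h0; omega
        constructor <;> nlinarith
      · have h' : x * y < -(y * y) := by by_contra! h2; exact hg ⟨h2, h⟩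
        have hypos : 0 < y * y := mul_self_pos.2 (by rintro rfl; simp at h)
        -- These are `y²` times `x (y + 2x)` and `(y + x)(y + 2x)`, whose positivity is the claim.
        have e1 : 0 < (x * y) * (y * y + 2 * (x * y)) := mul_pos_of_neg_of_neg h (by omega)
        have e2 : 0 < (y * y + x * y) * (y * y + 2 * (x * y)) :=
          mul_pos_of_neg_of_neg (by omega) (by omega)
        have e1' : 0 < x * (y + 2 * x) := by
          refine (mul_pos_iff_of_pos_right hypos).1 ?_
          nlinarith
        have e2' : 0 < (y + x) * (y + 2 * x) := by
          refine (mul_pos_iff_of_pos_right hypos).1 ?_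
          nlinarith
        constructor <;> nlinarith
    · rintro _ ⟨g, hg, rfl⟩
      rw [Set.mem_compl_iff, hYt] at hg
      change sanovGen true * g ∈ X true
      rw [hXt, sanovGen_true_mul_zero_zero, sanovGen_true_mul_one_zero]
      nlinarith
  · rintro (_ | _)
    · rintro _ ⟨g, hg, rfl⟩
      rw [Set.mem_compl_iff, hXf] at hg
      change (sanovGen false)⁻¹ * g ∈ Y false
      rw [hYf, sanovGen_false_inv_mul_zero_zero, sanovGen_false_inv_mul_one_zero]
      have h0 := sl_col_ne_zero g
      generalize g 0 0 = x at *
      generalize g 1 0 = y at *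
      have hx := mul_self_nonneg x
      have hy := mul_self_nonneg y
      rcases lt_or_ge (x * y) 0 with h | h
      · have hxpos : 0 < x * x := mul_self_pos.2 (by rintro rfl; simp at h)
        constructor <;> nlinarith
      · have h' : y * y ≤ x * y := by by_contra! h2; exact hg ⟨h, h2⟩
        rcases eq_or_ne y 0 with rfl | hy0
        · have hxpos : 0 < x * x := mul_self_pos.2 (by tauto)
          constructor <;> nlinarith
        · have hypos : 0 < y * y := mul_self_pos.2 hy0
          have e1 : 0 < (x * y) * (2 * (x * y) - y * y) := mul_pos (by omega) (by omega)
          have e2 : 0 ≤ (x * y - y * y) * (2 * (x * y) - y * y) :=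
            mul_nonneg (by omega) (by omega)
          have e1' : 0 < x * (2 * x - y) := by
            refine (mul_pos_iff_of_pos_right hypos).1 ?_
            nlinarith
          have e2' : 0 ≤ (x - y) * (2 * x - y) := by
            refine nonneg_of_mul_nonneg_left ?_ hypos
            nlinarith
          constructor <;> nlinarith
    · rintro _ ⟨g, hg, rfl⟩
      rw [Set.mem_compl_iff, hXt] at hg
      change (sanovGen true)⁻¹ * g ∈ Y true
      rw [hYt, sanovGen_true_inv_mul_zero_zero, sanovGen_true_inv_mul_one_zero]
      nlinarith

/-- The Sanov subgroup of `SL₂(ℤ)`, generated by `(1, 2; 0, 1)` and `(1, 0; 2, 1)`. -/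
def sanov : Subgroup SL(2, ℤ) := (FreeGroup.lift sanovGen).range

theorem sanovGen_mem (b : Bool) : sanovGen b ∈ sanov := ⟨FreeGroup.of b, FreeGroup.lift_apply_of⟩

instance : IsFreeGroup sanov :=
  IsFreeGroup.ofMulEquiv (MonoidHom.ofInjective injective_lift_sanovGen)

theorem sanovGen_true_zpow (n : ℤ) : sanovGen true ^ n = slOf 1 (2 * n) 0 1 (by ring) := by
  induction n with
  | zero =>
    apply Subtype.ext
    simp [slOf, Matrix.one_fin_two]
  | succ n ih =>
    rw [zpow_add_one, ih]
    apply Subtype.ext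
    change !![1, 2 * (n : ℤ); 0, 1] * !![1, 2; 0, 1] = !![1, 2 * ((n : ℤ) + 1); 0, 1]
    rw [Matrix.mul_fin_two]
    refine matrix_fin_two_congr ?_ ?_ ?_ ?_ <;> ring
  | pred n ih =>
    rw [zpow_sub_one, ih]
    rw [sanovGen_true_inv]
    apply Subtype.ext
    change !![1, 2 * (-(n : ℤ)); 0, 1] * !![1, -2; -0, 1] = !![1, 2 * (-(n : ℤ) - 1); 0, 1]
    rw [Matrix.mul_fin_two]
    refine matrix_fin_two_congr ?_ ?_ ?_ ?_ <;> ring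

theorem mem_or_neg_mem_sanov_of_mul {u g : SL(2, ℤ)} (hu : u ∈ sanov)
    (h : u * g ∈ sanov ∨ -(u * g) ∈ sanov) : g ∈ sanov ∨ -g ∈ sanov := by
  rw [← mul_neg] at h
  exact h.imp (Subgroup.mul_mem_cancel_left _ hu).1 (Subgroup.mul_mem_cancel_left _ hu).1

/-- Descent on the first column. Its entries have opposite parity, so their absolute values differ,
and while the lower one is nonzero, adding plus or minus twice the smaller to the larger decreases
the sum. At the end the matrix is a power of the upper generator up to sign. -/
theorem mem_or_neg_mem_sanov (n : ℕ) : ∀ g : SL(2, ℤ), (g 0 0).natAbs + (g 1 0).natAbs = n →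
    ¬ (2 : ℤ) ∣ g 0 0 → (2 : ℤ) ∣ g 1 0 → (2 : ℤ) ∣ g 0 1 → g ∈ sanov ∨ -g ∈ sanov := by
  induction n using Nat.strong_induction_on with
  | _ n ih =>
    intro g hn h00 h10 h01
    by_cases hc : g 1 0 = 0
    · have hdet : g 0 0 * g 1 1 = 1 := by
        have h := g.2
        rw [Matrix.det_fin_two] at h
        change g 0 0 * g 1 1 - g 0 1 * g 1 0 = 1 at h
        rwa [hc, mul_zero, sub_zero] at h
      obtain ⟨m, hm⟩ := h01
      rcases Int.mul_eq_one_iff_eq_one_or_neg_one.1 hdet with ⟨ha, hd⟩ | ⟨ha, hd⟩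
      · left
        have h : g = sanovGen true ^ m := by
          rw [sanovGen_true_zpow]
          apply Subtype.ext
          rw [Matrix.eta_fin_two g.1, ha, hm, hc, hd]
          rfl
        rw [h]
        exact zpow_mem (sanovGen_mem true) m
      · right
        have h : -g = sanovGen true ^ (-m) := by
          rw [sanovGen_true_zpow]
          apply Subtype.ext
          change -g.1 = !![1, 2 * (-m); 0, 1]
          rw [Matrix.eta_fin_two g.1, ha, hm, hc, hd]
          simp
        rw [h]
        exact zpow_mem (sanovGen_mem true) (-m)
    · have hcases : (g 0 0 + 2 * g 1 0).natAbs < (g 0 0).natAbs ∨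
          (g 0 0 + -(2 * g 1 0)).natAbs < (g 0 0).natAbs ∨
          (2 * g 0 0 + g 1 0).natAbs < (g 1 0).natAbs ∨
          (-(2 * g 0 0) + g 1 0).natAbs < (g 1 0).natAbs := by omega
      rcases hcases with h | h | h | h
      · refine mem_or_neg_mem_sanov_of_mul (sanovGen_mem true) (ih _ ?_ _ rfl ?_ ?_ ?_) <;>
          simp only [sanovGen_true_mul_zero_zero, sanovGen_true_mul_one_zero,
            sanovGen_true_mul_zero_one] <;> omega
      · refine mem_or_neg_mem_sanov_of_mul (inv_mem (sanovGen_mem true))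
          (ih _ ?_ _ rfl ?_ ?_ ?_) <;>
          simp only [sanovGen_true_inv_mul_zero_zero, sanovGen_true_inv_mul_one_zero,
            sanovGen_true_inv_mul_zero_one] <;> omega
      · refine mem_or_neg_mem_sanov_of_mul (sanovGen_mem false) (ih _ ?_ _ rfl ?_ ?_ ?_) <;>
          simp only [sanovGen_false_mul_zero_zero, sanovGen_false_mul_one_zero,
            sanovGen_false_mul_zero_one] <;> omega
      · refine mem_or_neg_mem_sanov_of_mul (inv_mem (sanovGen_mem false))
          (ih _ ?_ _ rfl ?_ ?_ ?_) <;>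
          simp only [sanovGen_false_inv_mul_zero_zero, sanovGen_false_inv_mul_one_zero,
            sanovGen_false_inv_mul_zero_one] <;> omega

theorem mem_or_neg_mem_sanov_of_mem_Gamma {g : SL(2, ℤ)} (hg : g ∈ CongruenceSubgroup.Gamma 2) :
    g ∈ sanov ∨ -g ∈ sanov := by
  rw [CongruenceSubgroup.Gamma_mem] at hg
  refine mem_or_neg_mem_sanov _ g rfl ?_ ?_ ?_
  · rw [← Nat.cast_ofNat, ← ZMod.intCast_zmod_eq_zero_iff_dvd, hg.1]
    exact one_ne_zero
  · exact (ZMod.intCast_zmod_eq_zero_iff_dvd _ 2).1 hg.2.2.1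
  · exact (ZMod.intCast_zmod_eq_zero_iff_dvd _ 2).1 hg.2.1

theorem sanov_le_Gamma : sanov ≤ CongruenceSubgroup.Gamma 2 := by
  rintro _ ⟨w, rfl⟩
  induction w using FreeGroup.induction_on with
  | C1 => exact one_mem _
  | of b =>
    rw [FreeGroup.lift_apply_of, CongruenceSubgroup.Gamma_mem]
    cases b <;> simp [sanovGen, slOf] <;> decide
  | inv_of b h => rw [map_inv]; exact inv_mem h
  | mul x y hx hy => rw [map_mul]; exact mul_mem hx hy

theorem Gamma_two_index_dvd : (CongruenceSubgroup.Gamma 2).index ∣ 6 := by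
  have h : Nat.card SL(2, ZMod 2) = 6 := by
    rw [Nat.card_eq_fintype_card]
    decide
  rw [← h]
  rw [CongruenceSubgroup.Gamma, Subgroup.index_ker]
  exact Subgroup.card_subgroup_dvd_card _

/-- The Sanov subgroup meets every subgroup of `SL₂(ℤ)` in a subgroup of index dividing `12`. -/
theorem sanov_relIndex_dvd (Γ : Subgroup SL(2, ℤ)) : sanov.relIndex Γ ∣ 12 := by
  -- The 12 is `6 * 2`: the order of `SL₂(𝔽₂)`, and the sign lost between `Γ(2)` and the Sanov
  -- subgroup.
  have h1 : (CongruenceSubgroup.Gamma 2 ⊓ Γ).relIndex Γ ∣ 6 := by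
    have := CongruenceSubgroup.Gamma_normal 2
    rw [Subgroup.inf_relIndex_right]
    exact (Subgroup.relIndex_dvd_index_of_normal _ _).trans Gamma_two_index_dvd
  have h2 : (sanov ⊓ Γ).relIndex (CongruenceSubgroup.Gamma 2 ⊓ Γ) ∣ 2 := by
    set L := CongruenceSubgroup.Gamma 2 ⊓ Γ
    have hLs : ∀ g : L, (g : SL(2, ℤ)) ∈ sanov ⊓ Γ ↔ (g : SL(2, ℤ)) ∈ sanov :=
      fun g => ⟨fun h => h.1, fun h => ⟨h, g.2.2⟩⟩
    by_cases hL : ∀ g : L, (g : SL(2, ℤ)) ∈ sanov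
    · have h3 : (sanov ⊓ Γ).relIndex L = 1 :=
        Subgroup.relIndex_eq_one.2 fun g hg => ⟨hL ⟨g, hg⟩, hg.2⟩
      rw [h3]
      exact one_dvd _
    · push Not at hL
      obtain ⟨a, ha⟩ := hL
      have ha' := (mem_or_neg_mem_sanov_of_mem_Gamma a.2.1).resolve_left ha
      have h3 : (sanov ⊓ Γ).relIndex L = 2 := by
        refine Subgroup.index_eq_two_iff.2 ⟨a, fun b => ?_⟩
        rw [Subgroup.mem_subgroupOf, Subgroup.mem_subgroupOf, hLs, hLs]
        by_cases hb : (b : SL(2, ℤ)) ∈ sanov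
        · refine Or.inr ⟨hb, fun h => ha ?_⟩
          exact (Subgroup.mul_mem_cancel_left _ hb).1 h
        · refine Or.inl ⟨?_, hb⟩
          have hb' := (mem_or_neg_mem_sanov_of_mem_Gamma b.2.1).resolve_left hb
          have h4 := mul_mem hb' ha'
          rwa [neg_mul_neg] at h4
      rw [h3]
  have h4 : (sanov ⊓ Γ).relIndex Γ = sanov.relIndex Γ := Subgroup.inf_relIndex_right _ _
  rw [← h4, ← Subgroup.relIndex_mul_relIndex (sanov ⊓ Γ) (CongruenceSubgroup.Gamma 2 ⊓ Γ) Γ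
    (inf_le_inf_right _ sanov_le_Gamma) inf_le_right]
  exact mul_dvd_mul h2 h1

theorem isFreeGroup_of_injective {K G : Type u} [Group K] [Group G] [IsFreeGroup G] (f : K →* G)
    (hf : Function.Injective f) : IsFreeGroup K :=
  IsFreeGroup.ofMulEquiv (MonoidHom.ofInjective hf).symm

/-- `Γ₀(N)` contains a free subgroup of index dividing `12`. -/
theorem exists_free_subgroup_Gamma0Q (N : ℕ) :
    ∃ Φ : Subgroup (Gamma0Q N), IsFreeGroup Φ ∧ Φ.index ∣ 12 := by
  let H : Subgroup (GL (Fin 2) ℚ) := sanov.map (Matrix.SpecialLinearGroup.mapGL ℚ)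
  have hH : IsFreeGroup H := IsFreeGroup.ofMulEquiv
    (sanov.equivMapOfInjective _ Matrix.SpecialLinearGroup.mapGL_injective)
  refine ⟨H.subgroupOf (Gamma0Q N), ?_, ?_⟩
  · let f : H.subgroupOf (Gamma0Q N) →* H :=
      { toFun := fun g => ⟨g.1.1, g.2⟩
        map_one' := rfl
        map_mul' := fun _ _ => rfl }
    refine isFreeGroup_of_injective f fun x y hxy => ?_
    have h : x.1.1 = y.1.1 := congrArg (fun w : H => (w : GL (Fin 2) ℚ)) hxy
    exact Subtype.ext (Subtype.ext h)
  · change H.relIndex (Gamma0Q N) ∣ 12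
    rw [← Subgroup.relIndex_comap, Subgroup.comap_map_eq_self_of_injective
      Matrix.SpecialLinearGroup.mapGL_injective]
    exact sanov_relIndex_dvd _

instance (N : ℕ) [NeZero N] : Group.FG (Gamma0Q N) := by
  have h1 : Group.FG SL(2, ℤ) := ⟨⟨{ModularGroup.S, ModularGroup.T}, by
    simpa using SpecialLinearGroup.SL2Z_generators⟩⟩
  have h2 : (CongruenceSubgroup.Gamma N).FiniteIndex :=
    (CongruenceSubgroup.Gamma_is_cong_sub N).finiteIndex
  have h3 : (Gamma0Row N).FiniteIndex := Subgroup.finiteIndex_of_le (gamma_le_gamma0Row N)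
  have h4 : Group.FG (Gamma0Row N) := inferInstance
  let e : Gamma0Row N ≃* Gamma0Q N :=
    (Gamma0Row N).equivMapOfInjective _ Matrix.SpecialLinearGroup.mapGL_injective
  exact Group.fg_of_surjective (f := e.toMonoidHom) e.surjective

end SanovSubgroup

/-! ### Lifting cocycles along surjections: free groups, then finite index. -/

section LiftingCocycles

variable {k : Type*} [Field k] {B C : Type*} [AddCommGroup B] [Module k B] [AddCommGroup C]
  [Module k C] (φ : B →ₗ[k] C) (hφ : Function.Surjective φ)

include hφ in
/-- Cocycles on a free group lift along surjections of coefficient modules. -/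
theorem exists_cocycle_lift_of_isFreeGroup {Φ : Type*} [Group Φ] [IsFreeGroup Φ]
    (ρ : Representation k Φ B) (σ : Representation k Φ C) (hφρ : ∀ g b, φ (ρ g b) = σ g (φ b))
    (z : Φ → C) (hz : ∀ g h, z (g * h) = σ g (z h) + z g) :
    ∃ w : Φ → B, (∀ g h, w (g * h) = ρ g (w h) + w g) ∧ ∀ g, φ (w g) = z g := by
  have hz1 : z 1 = 0 := by simpa using hz 1 1
  -- `Q` consists of pairs of `g` and an affine map `b ↦ ρ g b + c` with `φ c = z g`. A lift of `z`
  -- to a cocycle is a section of `Q → Φ`, and freeness provides one.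
  let Q : Subgroup (Φ × Equiv.Perm B) :=
    { carrier := {x | (∀ b, x.2 b = ρ x.1 b + x.2 0) ∧ φ (x.2 0) = z x.1}
      one_mem' := by simp [hz1]
      mul_mem' := by
        rintro ⟨g, e⟩ ⟨h, f⟩ ⟨he, he'⟩ ⟨hf, hf'⟩
        dsimp only at he he' hf hf'
        refine ⟨fun b => ?_, ?_⟩
        · change e (f b) = ρ (g * h) b + e (f 0)
          rw [he (f b), he (f 0), hf b, map_add, map_mul, Module.End.mul_apply, add_assoc]
        · change φ (e (f 0)) = z (g * h)
          rw [he, map_add, hφρ, hf', he', hz]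
      inv_mem' := by
        rintro ⟨g, e⟩ ⟨he, he'⟩
        dsimp only at he he'
        have hinv : ∀ b, e.symm b = ρ g⁻¹ (b - e 0) := by
          intro b
          rw [Equiv.symm_apply_eq, he, Representation.self_inv_apply, sub_add_cancel]
        refine ⟨fun b => ?_, ?_⟩
        · change e.symm b = ρ g⁻¹ b + e.symm 0
          rw [hinv, hinv 0, zero_sub, map_sub, map_neg, sub_eq_add_neg]
        · change φ (e.symm 0) = z g⁻¹
          have h1 := hz g⁻¹ g
          rw [inv_mul_cancel, hz1] at h1
          rw [hinv, zero_sub, map_neg, map_neg, hφρ, he', neg_eq_iff_add_eq_zero, ← h1] }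
  choose b hb using fun i : IsFreeGroup.Generators Φ => hφ (z (IsFreeGroup.of i))
  let e : IsFreeGroup.Generators Φ → Equiv.Perm B := fun i =>
    { toFun := fun x => ρ (IsFreeGroup.of i) x + b i
      invFun := fun x => ρ (IsFreeGroup.of i)⁻¹ (x - b i)
      left_inv := fun x => by simp
      right_inv := fun x => by simp }
  let L : Φ →* Q := IsFreeGroup.lift fun i => ⟨(IsFreeGroup.of i, e i), by
    refine ⟨fun x => ?_, ?_⟩
    · change ρ (IsFreeGroup.of i) x + b i = ρ (IsFreeGroup.of i) x + (ρ (IsFreeGroup.of i) 0 + b i)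
      rw [map_zero, zero_add]
    · change φ (ρ (IsFreeGroup.of i) 0 + b i) = z (IsFreeGroup.of i)
      rw [map_zero, zero_add, hb]⟩
  have hL : (MonoidHom.fst Φ (Equiv.Perm B)).comp (Q.subtype.comp L) = MonoidHom.id Φ := by
    refine IsFreeGroup.ext_hom fun i => ?_
    simp [L]
  have hL' : ∀ g, (L g).1.1 = g := fun g => DFunLike.congr_fun hL g
  refine ⟨fun g => (L g).1.2 0, fun g h => ?_, fun g => ?_⟩
  · have h1 := (L g).2.1 ((L h).1.2 0)
    rw [hL'] at h1
    beta_reduce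
    rw [← h1, map_mul]
    rfl
  · have h1 := (L g).2.2
    rwa [hL'] at h1

section Corestriction

variable {Γ : Type*} [Group Γ] (Φ : Subgroup Γ)

/-- For `γ ∈ Γ` and a coset `x`, the element `r_x⁻¹ γ r_y` of `Φ`, where `y = γ⁻¹ x`. -/
def corTransfer (γ : Γ) (x : Γ ⧸ Φ) : Φ :=
  ⟨x.out⁻¹ * γ * (γ⁻¹ • x).out, by
    rw [mul_assoc, ← QuotientGroup.eq]
    have h : ((γ * (γ⁻¹ • x).out : Γ) : Γ ⧸ Φ) = γ • (((γ⁻¹ • x).out : Γ) : Γ ⧸ Φ) := rfl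
    rw [h, QuotientGroup.out_eq', QuotientGroup.out_eq', smul_inv_smul]⟩

theorem corTransfer_mul (γ δ : Γ) (x : Γ ⧸ Φ) :
    corTransfer Φ (γ * δ) x = corTransfer Φ γ x * corTransfer Φ δ (γ⁻¹ • x) := by
  apply Subtype.ext
  simp [corTransfer, mul_assoc, mul_smul]

theorem out_mul_corTransfer (γ : Γ) (x : Γ ⧸ Φ) :
    x.out * corTransfer Φ γ x = γ * (γ⁻¹ • x).out := by
  simp [corTransfer, mul_assoc]

include hφ in
/-- If cocycles on a subgroup of finite index invertible in `k` lift along a surjection of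
coefficient modules, then so do cocycles on the whole group. -/
theorem exists_cocycle_lift_of_index [Φ.FiniteIndex] (hΦ : (Φ.index : k) ≠ 0)
    (ρ : Representation k Γ B) (σ : Representation k Γ C) (hφρ : ∀ g b, φ (ρ g b) = σ g (φ b))
    (z : Γ → C) (hz : ∀ g h, z (g * h) = σ g (z h) + z g) (w₀ : Φ → B)
    (hw₀ : ∀ g h : Φ, w₀ (g * h) = ρ g (w₀ h) + w₀ g) (hw₀z : ∀ g : Φ, φ (w₀ g) = z g) :
    ∃ w : Γ → B, (∀ g h, w (g * h) = ρ g (w h) + w g) ∧ ∀ g, φ (w g) = z g := by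
  have : Fintype (Γ ⧸ Φ) := Fintype.ofFinite _
  -- The corestriction of `w₀`.
  let w₁ : Γ → B := fun γ => ∑ x : Γ ⧸ Φ, ρ x.out (w₀ (corTransfer Φ γ x))
  have hw₁ : ∀ g h, w₁ (g * h) = ρ g (w₁ h) + w₁ g := by
    intro g h
    change ∑ x : Γ ⧸ Φ, ρ x.out (w₀ (corTransfer Φ (g * h) x))
      = ρ g (∑ x : Γ ⧸ Φ, ρ x.out (w₀ (corTransfer Φ h x)))
        + ∑ x : Γ ⧸ Φ, ρ x.out (w₀ (corTransfer Φ g x))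
    rw [map_sum, ← Equiv.sum_comp (MulAction.toPerm (g⁻¹ : Γ))
      (fun x : Γ ⧸ Φ => ρ g (ρ x.out (w₀ (corTransfer Φ h x)))), ← Finset.sum_add_distrib]
    refine Finset.sum_congr rfl fun x _ => ?_
    rw [corTransfer_mul, hw₀, map_add, MulAction.toPerm_apply, ← Module.End.mul_apply, ← map_mul,
      out_mul_corTransfer, map_mul, Module.End.mul_apply]
  let m : C := ∑ x : Γ ⧸ Φ, z x.out
  -- Corestriction after restriction is the index, up to the coboundary of `m`; this coboundary
  -- lifts to `B` and is subtracted below.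
  have hw₁z : ∀ g, φ (w₁ g) = (Φ.index : k) • z g + (σ g m - m) := by
    intro g
    have h1 : ∀ x : Γ ⧸ Φ, φ (ρ x.out (w₀ (corTransfer Φ g x)))
        = z g + (σ g (z (g⁻¹ • x).out) - z x.out) := by
      intro x
      have h2 := hz x.out (corTransfer Φ g x)
      rw [out_mul_corTransfer, hz] at h2
      rw [hφρ, hw₀z, eq_sub_of_add_eq h2.symm]
      abel
    have h3 : ∑ x : Γ ⧸ Φ, σ g (z (g⁻¹ • x).out) = σ g m := by
      rw [map_sum]
      exact Equiv.sum_comp (MulAction.toPerm (g⁻¹ : Γ)) (fun x : Γ ⧸ Φ => σ g (z x.out))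
    change φ (∑ x : Γ ⧸ Φ, ρ x.out (w₀ (corTransfer Φ g x))) = _
    rw [map_sum, Finset.sum_congr rfl fun x _ => h1 x, Finset.sum_add_distrib,
      Finset.sum_sub_distrib, h3, Finset.sum_const, Finset.card_univ, ← Nat.card_eq_fintype_card,
      ← Subgroup.index, Nat.cast_smul_eq_nsmul]
  obtain ⟨b, hb⟩ := hφ m
  refine ⟨fun g => (Φ.index : k)⁻¹ • (w₁ g - (ρ g b - b)), fun g h => ?_, fun g => ?_⟩
  · beta_reduce
    rw [hw₁, map_smul, ← smul_add]
    congr 1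
    rw [map_mul, Module.End.mul_apply, map_sub, map_sub]
    abel
  · rw [map_smul, map_sub, map_sub, hw₁z, hφρ, hb, add_sub_cancel_right, smul_smul,
      inv_mul_cancel₀ hΦ, one_smul]

end Corestriction

end LiftingCocycles

namespace HeckeH1

/-- `H¹(Γ₀(N), ·)` is right exact in characteristic `p > 3`. -/
theorem mapH1_surjective {p N : ℕ} [Fact p.Prime] (hp : 3 < p) [NeZero N] {k B C : Type} [Field k]
    [CharP k p] [AddCommGroup B] [Module k B] [AddCommGroup C] [Module k C]
    {ρ : Representation k (heckeSemigroup p N) B} {σ : Representation k (heckeSemigroup p N) C}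
    (φ : B →ₗ[k] C) (hφρ : ∀ s b, φ (ρ s b) = σ s (φ b)) (hφ : Function.Surjective φ) :
    Function.Surjective (mapH1 (Gamma0Q N) φ hφρ) := by
  intro c
  obtain ⟨z, rfl⟩ := proj_surjective _ _ c
  obtain ⟨Φ, hΦ, hdvd⟩ := exists_free_subgroup_Gamma0Q N
  have hindex : (Φ.index : k) ≠ 0 := by
    rw [Ne, CharP.cast_eq_zero_iff k p]
    intro h
    have hprime : p.Prime := Fact.out
    have h12 : p ∣ 2 * 2 * 3 := h.trans hdvd
    rw [hprime.dvd_mul, hprime.dvd_mul] at h12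
    rcases h12 with (h12 | h12) | h12
    all_goals have := Nat.le_of_dvd (by norm_num) h12; omega
  have : Φ.FiniteIndex := ⟨fun h => hindex (by rw [h, Nat.cast_zero])⟩
  have hz := (mem_cocycles_iff _ _ _).1 z.2
  let ρ' : Representation k (Gamma0Q N) B := ρ.comp (incl _ _)
  let σ' : Representation k (Gamma0Q N) C := σ.comp (incl _ _)
  obtain ⟨w₀, hw₀, hw₀z⟩ := exists_cocycle_lift_of_isFreeGroup φ hφ (ρ'.comp Φ.subtype)
    (σ'.comp Φ.subtype) (fun g b => hφρ _ _) (fun g => z.1 g) (fun g h => hz g h)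
  obtain ⟨w, hw, hwz⟩ := exists_cocycle_lift_of_index φ hφ Φ hindex ρ' σ' (fun g b => hφρ _ _) z.1 hz
    w₀ hw₀ hw₀z
  refine ⟨proj _ _ ⟨w, (mem_cocycles_iff _ _ _).2 hw⟩, ?_⟩
  rw [mapH1_proj]
  congr 1
  exact Subtype.ext (funext hwz)

end HeckeH1

namespace HeckeH1

/-! ### Local finiteness of `H¹` under the Hecke operators. -/

section LocalFiniteness

variable {G k : Type u} [Group G] [Field k] {Δ : Submonoid G} {Γ : Subgroup G}
  [hΓ : IsHeckeTriple Δ Γ Γ] {A : Type u} [AddCommGroup A] [Module k A]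
  {ρ : Representation k Δ A}

/-- With `V = ⊥` this says that a cocycle is determined by its values on generators; with `V` a span
of orbits it confines the values to a finite-dimensional space. -/
theorem cocycle_mem_of_closure {S : Set Γ} (hS : Subgroup.closure S = ⊤) {z : Γ → A}
    (hz : z ∈ groupCohomology.cocycles₁ (res Γ ρ)) (V : Submodule k A)
    (hV : ∀ s, ∀ v ∈ V, ρ s v ∈ V) (hzS : ∀ γ ∈ S, z γ ∈ V) (γ : Γ) : z γ ∈ V := by
  rw [mem_cocycles_iff] at hz
  have hz1 : z 1 = 0 := by simpa using hz 1 1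
  have hγ : γ ∈ Subgroup.closure S := by rw [hS]; trivial
  induction hγ using Subgroup.closure_induction with
  | mem γ h => exact hzS γ h
  | one => rw [hz1]; exact V.zero_mem
  | mul γ δ _ _ h h' => rw [hz]; exact V.add_mem (hV _ _ h') h
  | inv γ _ h =>
    have h1 := hz γ⁻¹ γ
    rw [inv_mul_cancel, hz1] at h1
    rw [eq_neg_of_add_eq_zero_right h1.symm]
    exact V.neg_mem (hV _ _ h)

/-- If `Γ` is finitely generated and the orbits of `Δ` in `A` are finite, then `H¹(Γ, A)` is a
locally finite Hecke module. -/
theorem exists_finiteDimensional_stable [hfg : Group.FG Γ]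
    (hfin : ∀ a : A, (Set.range fun s => ρ s a).Finite) (c : H1 Γ ρ) :
    ∃ W : Submodule k (H1 Γ ρ), FiniteDimensional k W ∧ c ∈ W ∧
      ∀ s, ∀ v ∈ W, heckeOp Γ ρ s v ∈ W := by
  obtain ⟨z, rfl⟩ := proj_surjective Γ ρ c
  obtain ⟨S, hS⟩ := hfg.1
  let V : Submodule k A := Submodule.span k (⋃ γ ∈ S, Set.range fun s => ρ s (z.1 γ))
  have hVfin : FiniteDimensional k V := FiniteDimensional.span_of_finite k
    (S.finite_toSet.biUnion fun γ _ => hfin (z.1 γ))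
  have hV : ∀ s, ∀ v ∈ V, ρ s v ∈ V := by
    intro s v hv
    have h1 : V ≤ V.comap (ρ s) := by
      refine Submodule.span_le.2 fun x hx => ?_
      obtain ⟨γ, hγ, t, rfl⟩ := Set.mem_iUnion₂.1 hx
      refine Submodule.subset_span (Set.mem_iUnion₂.2 ⟨γ, hγ, s * t, ?_⟩)
      simp
    exact h1 hv
  -- Cocycles with values in `V` are preserved by Hecke operators because `V` is `Δ`-stable, and
  -- they embed in `V ^ S`.
  let Z : Submodule k (groupCohomology.cocycles₁ (res Γ ρ)) :=
    { carrier := {w | ∀ γ, w.1 γ ∈ V}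
      zero_mem' := fun _ => V.zero_mem
      add_mem' := fun h h' γ => V.add_mem (h γ) (h' γ)
      smul_mem' := fun a _ h γ => V.smul_mem a (h γ) }
  have hZfin : FiniteDimensional k Z := by
    let r : Z →ₗ[k] (S → V) :=
      { toFun := fun w γ => ⟨w.1.1 γ, w.2 γ⟩
        map_add' := fun _ _ => rfl
        map_smul' := fun _ _ => rfl }
    refine Module.Finite.of_injective r fun w w' hw => ?_
    refine Subtype.ext (Subtype.ext (funext fun γ => sub_eq_zero.1 ?_))
    refine (Submodule.mem_bot k).1 (cocycle_mem_of_closure hS (w.1 - w'.1).2 ⊥ ?_ ?_ γ)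
    · intro s v hv
      rw [(Submodule.mem_bot k).1 hv, map_zero]
      exact Submodule.zero_mem _
    · intro γ hγ
      exact (Submodule.mem_bot k).2 (sub_eq_zero.2 (congrArg Subtype.val (congrFun hw ⟨γ, hγ⟩)))
  refine ⟨Z.map (proj Γ ρ), inferInstance, ⟨z, ?_, rfl⟩, ?_⟩
  · refine cocycle_mem_of_closure hS z.2 V hV fun γ hγ => Submodule.subset_span ?_
    refine Set.mem_iUnion₂.2 ⟨γ, hγ, 1, ?_⟩
    simp
  · rintro s _ ⟨w, hw, rfl⟩
    refine ⟨cocycleOp Γ ρ s w, fun γ => ?_, (heckeOp_proj Γ ρ s w).symm⟩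
    exact V.sum_mem fun x _ => hV _ _ (hw _)

end LocalFiniteness

/-! ### The connecting map and its Hecke equivariance. -/

section ConnectingMap

variable {G k : Type u} [Group G] [CommRing k] {Δ : Submonoid G} (Γ : Subgroup G)
  [hΓ : IsHeckeTriple Δ Γ Γ] {A B : Type u} [AddCommGroup A] [Module k A] [AddCommGroup B]
  [Module k B] {σ : Representation k Δ A} (ρ : Representation k Δ B) (i : A →ₗ[k] B)

/-- The elements of `B` which are `Γ`-invariant modulo the image of `A`. -/
def invariantsMod : Submodule k B where
  carrier := {b | ∀ γ : Γ, ρ (incl Δ Γ γ) b - b ∈ LinearMap.range i}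
  zero_mem' := fun _ => by simp
  add_mem' := fun {a b} ha hb γ => by
    rw [map_add, add_sub_add_comm]
    exact add_mem (ha γ) (hb γ)
  smul_mem' := fun c b hb γ => by
    rw [map_smul, ← smul_sub]
    exact Submodule.smul_mem _ _ (hb γ)

variable {Γ ρ i}

theorem mapH1_eq_zero (hi : ∀ s a, i (σ s a) = ρ s (i a)) {c : H1 Γ σ}
    (hc : mapH1 Γ i hi c = 0) : ∃ z : groupCohomology.cocycles₁ (res Γ σ), proj Γ σ z = c ∧
      ∃ b ∈ invariantsMod Γ ρ i, ∀ γ, i (z.1 γ) = ρ (incl Δ Γ γ) b - b := by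
  obtain ⟨z, rfl⟩ := proj_surjective Γ σ c
  rw [mapH1_proj, proj_eq_zero_iff] at hc
  obtain ⟨b, hb⟩ := hc
  exact ⟨z, rfl, b, fun γ => ⟨z.1 γ, (hb γ).symm⟩, fun γ => (hb γ).symm⟩

/-- The connecting map from the invariants of `B / A` to `H¹(Γ, A)`, on representatives. -/
def connecting (hi : ∀ s a, i (σ s a) = ρ s (i a)) (hinj : Function.Injective i) :
    invariantsMod Γ ρ i →ₗ[k] groupCohomology.cocycles₁ (res Γ σ) :=
  let e := LinearEquiv.ofInjective i hinj
  have he : ∀ y, i (e.symm y) = y := fun y => congrArg Subtype.val (e.apply_symm_apply y)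
  { toFun := fun b => ⟨fun γ => e.symm ⟨_, b.2 γ⟩, by
      rw [mem_cocycles_iff]
      intro γ δ
      apply hinj
      rw [map_add, hi, he, he, he]
      change ρ (incl Δ Γ (γ * δ)) b.1 - b.1
        = ρ (incl Δ Γ γ) (ρ (incl Δ Γ δ) b.1 - b.1) + (ρ (incl Δ Γ γ) b.1 - b.1)
      rw [map_mul, map_mul, Module.End.mul_apply, map_sub]
      abel⟩
    map_add' := fun b c => Subtype.ext (funext fun γ => hinj (by
      change i (e.symm _) = i (e.symm _ + e.symm _)
      rw [map_add, he, he, he]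
      change ρ _ (b.1 + c.1) - (b.1 + c.1) = _
      rw [map_add, add_sub_add_comm]))
    map_smul' := fun a b => Subtype.ext (funext fun γ => hinj (by
      change i (e.symm _) = i (a • e.symm _)
      rw [map_smul, he, he]
      change ρ _ (a • b.1) - a • b.1 = _
      rw [map_smul, smul_sub])) }

variable (hi : ∀ s a, i (σ s a) = ρ s (i a)) (hinj : Function.Injective i)

theorem connecting_spec (b : invariantsMod Γ ρ i) (γ : Γ) :
    i ((connecting hi hinj b).1 γ) = ρ (incl Δ Γ γ) b - b :=
  congrArg Subtype.val ((LinearEquiv.ofInjective i hinj).apply_symm_apply _)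

theorem proj_connecting_eq_zero (b : invariantsMod Γ ρ i) (hb : (b : B) ∈ LinearMap.range i) :
    proj Γ σ (connecting hi hinj b) = 0 := by
  obtain ⟨a, ha⟩ := hb
  rw [proj_eq_zero_iff]
  refine ⟨a, fun γ => hinj ?_⟩
  rw [connecting_spec, map_sub, hi, ha]

/-- If all the elements of `Γ s Γ` in `Δ` act in the same way on an invariant `b` of `B / A`, then
the Hecke operator acts on its image in `H¹(Γ, A)` through `s`, up to the degree. -/
theorem heckeOp_connecting (s : Δ) (b b' : invariantsMod Γ ρ i)
    (h : ∀ x : cosets Γ (s : G), ρ (rep Δ Γ x) b - b' ∈ LinearMap.range i) :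
    heckeOp Γ σ s (proj Γ σ (connecting hi hinj b))
      = (degree Γ (s : G) : k) • proj Γ σ (connecting hi hinj b') := by
  have := finite_cosets Δ Γ s
  rw [heckeOp_proj, ← map_smul, ← sub_eq_zero, ← map_sub, proj_eq_zero_iff]
  choose a ha using h
  have hcard : (degree Γ (s : G) : k) • (b' : B) = ∑ _x : cosets Γ (s : G), (b' : B) := by
    rw [Finset.sum_const, Finset.card_univ, ← Nat.card_eq_fintype_card, Nat.cast_smul_eq_nsmul]
    rfl
  refine ⟨∑ x, a x, fun γ => hinj ?_⟩
  have h1 : i ((cocycleOp Γ σ s (connecting hi hinj b)).1 γ)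
      = ρ (incl Δ Γ γ) (∑ x : cosets Γ (s : G), ρ (rep Δ Γ x) b)
        - ∑ x : cosets Γ (s : G), ρ (rep Δ Γ x) b := by
    change i (∑ x : cosets Γ (s : G), σ (rep Δ Γ x)
      ((connecting hi hinj b).1 (transfer Δ Γ γ x))) = _
    rw [map_sum, map_sum, ← Equiv.sum_comp (MulAction.toPerm (γ⁻¹ : Γ))
      (fun x : cosets Γ (s : G) => ρ (incl Δ Γ γ) (ρ (rep Δ Γ x) b)), ← Finset.sum_sub_distrib]
    refine Finset.sum_congr rfl fun x _ => ?_
    rw [hi, connecting_spec, map_sub, MulAction.toPerm_apply, ← Module.End.mul_apply,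
      ← Module.End.mul_apply, ← map_mul, ← map_mul, rep_mul_incl]
  have h2 : i (∑ x, a x) = (∑ x : cosets Γ (s : G), ρ (rep Δ Γ x) b)
      - (degree Γ (s : G) : k) • (b' : B) := by
    rw [map_sum, hcard, ← Finset.sum_sub_distrib]
    exact Finset.sum_congr rfl fun x _ => ha x
  change i (σ (incl Δ Γ γ) (∑ x, a x) - ∑ x, a x)
    = i ((cocycleOp Γ σ s (connecting hi hinj b)).1 γ
      - (degree Γ (s : G) : k) • (connecting hi hinj b').1 γ)
  rw [map_sub, map_sub, hi, h1, h2, map_smul, connecting_spec, map_sub, map_smul, smul_sub]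
  abel

end ConnectingMap

end HeckeH1

/-! ### Eigenclasses killed by enlarging the coefficients. -/

section Kernel

open HeckeH1

variable {p N : ℕ} [Fact p.Prime] [NeZero N] {F : Type*} [Field F] [CharP F p]

omit [Fact p.Prime] in
theorem det_intMatrix_rep (s : heckeSemigroup p N) (x : cosets (Gamma0Q N) s.1) :
    (intMatrix (rep (heckeSemigroup p N) (Gamma0Q N) x)).det = (intMatrix s).det := by
  obtain ⟨γ, hγ, δ, hδ, h⟩ := rep_inDoubleCoset x
  have h1 : rep (heckeSemigroup p N) (Gamma0Q N) x
      = incl _ _ ⟨γ, hγ⟩ * s * incl _ _ ⟨δ, hδ⟩ := Subtype.ext h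
  rw [h1, intMatrix_mul, intMatrix_mul, Matrix.det_mul, Matrix.det_mul, det_intMatrix_incl,
    det_intMatrix_incl, one_mul, mul_one]

variable {A B : Type} [AddCommGroup A] [Module (AlgebraicClosure (ZMod p)) A]
    [AddCommGroup B] [Module (AlgebraicClosure (ZMod p)) B]
    {ρA : Representation (AlgebraicClosure (ZMod p)) (GL (Fin 2) F) A}
    {ρB : Representation (AlgebraicClosure (ZMod p)) (GL (Fin 2) F) B}
    {i : A →ₗ[AlgebraicClosure (ZMod p)] B} (hi : ∀ g a, i (ρA g a) = ρB g (i a))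

/-- The reduction of the determinant of an element of the Hecke semigroup. -/
def detUnit (s : heckeSemigroup p N) : (ZMod p)ˣ :=
  Units.mk0 ((intMatrix s).det : ZMod p) (by
    have h := det_intMatrix_ne_zero (ZMod p) s
    rwa [← RingHom.map_det] at h)

omit [NeZero N] in
theorem detUnit_mul (s t : heckeSemigroup p N) : detUnit (s * t) = detUnit s * detUnit t := by
  apply Units.ext
  simp [detUnit, intMatrix_mul]

theorem detUnit_incl (γ : Gamma0Q N) :
    detUnit (incl (heckeSemigroup p N) (Gamma0Q N) γ) = 1 := by
  apply Units.ext
  simp [detUnit, det_intMatrix_incl]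

theorem detUnit_rep (s : heckeSemigroup p N) (x : cosets (Gamma0Q N) s.1) :
    detUnit (rep (heckeSemigroup p N) (Gamma0Q N) x) = detUnit s := by
  apply Units.ext
  simp [detUnit, det_intMatrix_rep]

omit [NeZero N] in
theorem detChar_eq (s : heckeSemigroup p N) :
    detChar N s = algebraMap (ZMod p) (AlgebraicClosure (ZMod p)) (detUnit s : ZMod p) := by
  simp [detChar, detUnit]

omit [CharP F p] in
include hi in
theorem apply_mem_range (g : GL (Fin 2) F) {b : B} (hb : b ∈ LinearMap.range i) :
    ρB g b ∈ LinearMap.range i := by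
  obtain ⟨a, rfl⟩ := hb
  exact ⟨ρA g a, hi g a⟩

include hi in
/-- On the invariants of `B / A` the Hecke semigroup acts through the determinant. -/
theorem sub_mem_range_of_detUnit_eq {s t : heckeSemigroup p N} (h : detUnit s = detUnit t) {b : B}
    (hb : b ∈ invariantsMod (Gamma0Q N) (heckeModule N ρB) i) :
    heckeModule N ρB s b - heckeModule N ρB t b ∈ LinearMap.range i := by
  have hdvd : (p : ℤ) ∣ (intMatrix s).det - (intMatrix t).det := by
    rw [← ZMod.intCast_zmod_eq_zero_iff_dvd, Int.cast_sub, sub_eq_zero]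
    exact congrArg Units.val h
  -- The reductions differ by a right factor from `Γ₀(N)`, which fixes `b` modulo `A`.
  obtain ⟨γ, hγ⟩ := exists_reduction_eq_mul F s t hdvd
  change ρB (reduction p N F s) b - ρB (reduction p N F t) b ∈ _
  rw [hγ, map_mul, Module.End.mul_apply, ← map_sub]
  exact apply_mem_range hi _ (hb γ)

include hi in
theorem apply_mem_invariantsMod (s : heckeSemigroup p N) {b : B}
    (hb : b ∈ invariantsMod (Gamma0Q N) (heckeModule N ρB) i) :
    heckeModule N ρB s b ∈ invariantsMod (Gamma0Q N) (heckeModule N ρB) i := by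
  intro γ
  rw [← Module.End.mul_apply, ← map_mul]
  exact sub_mem_range_of_detUnit_eq hi (by rw [detUnit_mul, detUnit_incl, one_mul]) hb

theorem exists_detUnit_eq (p N : ℕ) [Fact p.Prime] [NeZero N] (d : (ZMod p)ˣ) :
    ∃ s : heckeSemigroup p N, detUnit s = d := by
  obtain ⟨s, hs⟩ := exists_det_eq (N := N) d
  exact ⟨s, Units.ext hs⟩

/-- The embedding of `𝔽_pˣ` in the units of its algebraic closure. -/
def unitsEmb (p : ℕ) [Fact p.Prime] : (ZMod p)ˣ →* (AlgebraicClosure (ZMod p))ˣ :=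
  Units.map (algebraMap (ZMod p) (AlgebraicClosure (ZMod p)))

/-- Orthogonality of the characters of `𝔽_pˣ`; the `-1` is the group order `p - 1` in characteristic
`p`. -/
theorem sum_unitsEmb_pow (d : (ZMod p)ˣ) :
    ∑ j ∈ Finset.range (p - 1), ((unitsEmb p d⁻¹ : AlgebraicClosure (ZMod p))) ^ j
      = if d = 1 then -1 else 0 := by
  have hp1 : 1 ≤ p := (Fact.out : p.Prime).one_lt.le
  split_ifs with h
  · subst h
    simp [Nat.cast_sub hp1]
  · have h1 : ((unitsEmb p d⁻¹ : AlgebraicClosure (ZMod p))) ≠ 1 := by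
      intro h1
      apply h
      have h2 : algebraMap (ZMod p) (AlgebraicClosure (ZMod p)) ((d⁻¹ : (ZMod p)ˣ) : ZMod p)
          = algebraMap (ZMod p) (AlgebraicClosure (ZMod p)) 1 := by rw [map_one]; exact h1
      have h3 := (algebraMap (ZMod p) (AlgebraicClosure (ZMod p))).injective h2
      exact inv_eq_one.1 (Units.ext h3)
    have h2 := geom_sum_mul (unitsEmb p d⁻¹ : AlgebraicClosure (ZMod p)) (p - 1)
    rw [← Units.val_pow_eq_pow_val, ← map_pow, ZMod.units_pow_card_sub_one_eq_one, map_one,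
      Units.val_one, sub_self] at h2
    exact (mul_eq_zero.1 h2).resolve_right (sub_ne_zero.2 h1)

/-- An eigenclass which dies in `H¹` of a larger module has the system of eigenvalues of a twist of
a punctual eigenclass. -/
theorem exists_eq_detChar_pow_mul_degree (hinj : Function.Injective i)
    {a : heckeSemigroup p N → AlgebraicClosure (ZMod p)} {c : H1 (Gamma0Q N) (heckeModule N ρA)}
    (hc : IsEigenclass (Gamma0Q N) (heckeModule N ρA) a c)
    (h0 : mapH1 (Gamma0Q N) (σ := heckeModule N ρB) i (fun s => hi (reduction p N F s)) c = 0) :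
    ∃ j : ℕ, a = fun s => detChar N s ^ j *
      (degree (Gamma0Q N) s.1 : AlgebraicClosure (ZMod p)) := by
  let k := AlgebraicClosure (ZMod p)
  let hi' : ∀ (s : heckeSemigroup p N) (x : A), i (heckeModule N ρA s x) = heckeModule N ρB s (i x) :=
    fun s => hi (reduction p N F s)
  obtain ⟨z, hz, b, hb, hzb⟩ := mapH1_eq_zero hi' h0
  let X := invariantsMod (Gamma0Q N) (heckeModule N ρB) i
  let D : X →ₗ[k] H1 (Gamma0Q N) (heckeModule N ρA) :=
    proj (Gamma0Q N) (heckeModule N ρA) ∘ₗ connecting hi' hinj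
  have hDb : D ⟨b, hb⟩ = c := by
    rw [← hz]
    change proj _ _ _ = _
    congr 1
    refine Subtype.ext (funext fun γ => hinj ?_)
    rw [hzb, connecting_spec]
  choose τ hτ using exists_detUnit_eq p N
  let v : (ZMod p)ˣ → X := fun d => ⟨heckeModule N ρB (τ d) b, apply_mem_invariantsMod hi _ hb⟩
  -- Modulo `A`, `v d` is the action of `d ∈ 𝔽_pˣ` on `b`, and `-β j` is the projection of `b` to
  -- the `det ^ j`-component, the sign being the inverse of `p - 1`.
  let β : ℕ → X := fun j => ∑ d, ((unitsEmb p d⁻¹ : k) ^ j) • v d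
  have hβ : ∀ j, (β j : B) = ∑ d, ((unitsEmb p d⁻¹ : k) ^ j) • heckeModule N ρB (τ d) b := by
    intro j
    simp only [β, v, AddSubmonoidClass.coe_finsetSum, SetLike.val_smul]
  have hsum : ∑ j ∈ Finset.range (p - 1), D (-β j) = c := by
    rw [← map_sum, ← hDb, ← sub_eq_zero, ← map_sub]
    refine proj_connecting_eq_zero hi' hinj _ ?_
    have h1 : ∑ j ∈ Finset.range (p - 1), β j = - v 1 := by
      simp only [β]
      rw [Finset.sum_comm]
      simp only [← Finset.sum_smul, sum_unitsEmb_pow, ite_smul, zero_smul, neg_smul, one_smul,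
        Finset.sum_ite_eq', Finset.mem_univ, if_true]
    rw [Finset.sum_neg_distrib, h1, neg_neg]
    have h2 := sub_mem_range_of_detUnit_eq hi (s := τ 1) (t := 1)
      (by rw [hτ, ← detUnit_incl (p := p) (N := N) 1, map_one]) hb
    rwa [map_one] at h2
  have heig : ∀ j s, heckeOp (Gamma0Q N) (heckeModule N ρA) s (D (-β j))
      = (detChar N s ^ j * (degree (Gamma0Q N) s.1 : k)) • D (-β j) := by
    intro j s
    -- Translating the summation variable by the determinant of `s` brings out the factor
    -- `det(s)^j`.
    have hshift : ∀ t : heckeSemigroup p N, detUnit t = detUnit s →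
        heckeModule N ρB t (β j) - ((detChar N s ^ j) • β j : X) ∈ LinearMap.range i := by
      intro t ht
      have h1 : (((detChar N s ^ j) • β j : X) : B)
          = ∑ d, ((unitsEmb p d⁻¹ : k) ^ j) • heckeModule N ρB (τ (detUnit s * d)) b := by
        rw [SetLike.val_smul, hβ, ← Equiv.sum_comp (Equiv.mulLeft (detUnit s)), Finset.smul_sum]
        refine Finset.sum_congr rfl fun d _ => ?_
        rw [smul_smul, Equiv.coe_mulLeft, ← mul_pow]
        congr 2
        rw [detChar_eq, mul_inv_rev, map_mul, Units.val_mul, mul_comm, mul_assoc]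
        have h2 : (unitsEmb p (detUnit s)⁻¹ : k)
            * algebraMap (ZMod p) k (detUnit s : ZMod p) = 1 := by
          change (unitsEmb p (detUnit s)⁻¹ : k) * (unitsEmb p (detUnit s) : k) = 1
          rw [← Units.val_mul, ← map_mul, inv_mul_cancel, map_one, Units.val_one]
        rw [h2, mul_one]
      rw [h1, hβ, map_sum, ← Finset.sum_sub_distrib]
      refine Submodule.sum_mem _ fun d _ => ?_
      rw [map_smul, ← smul_sub, ← Module.End.mul_apply, ← map_mul]
      refine Submodule.smul_mem _ _ (sub_mem_range_of_detUnit_eq hi ?_ hb)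
      rw [detUnit_mul, hτ, hτ, ht]
    have h1 := heckeOp_connecting hi' hinj s (β j) ((detChar N s ^ j) • β j)
      fun x => hshift _ (detUnit_rep s x)
    rw [map_neg, map_neg, smul_neg, mul_comm, mul_smul, ← map_smul]
    exact congrArg Neg.neg h1
  obtain ⟨j, -, hj⟩ := exists_eq_of_eigenvector_sum
    (fun s => heckeOp (Gamma0Q N) (heckeModule N ρA) s)
    (fun (j : ℕ) s => detChar N s ^ j * (degree (Gamma0Q N) s.1 : k)) a (Finset.range (p - 1))
    (fun j => D (-β j)) (fun j _ s => heig j s) (by rw [hsum]; exact hc.2) (by rw [hsum]; exact hc.1)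
  exact ⟨j, hj⟩

end Kernel

theorem finite_range_heckeModule {p : ℕ} [Fact p.Prime] (N : ℕ) {F : Type*} [Field F] [CharP F p]
    {V : Type} [AddCommGroup V] [Module (AlgebraicClosure (ZMod p)) V]
    (ρ : Representation (AlgebraicClosure (ZMod p)) (GL (Fin 2) F) V) (v : V) :
    (Set.range fun s => heckeModule N ρ s v).Finite := by
  have h : (Set.range fun s => heckeModule N ρ s v)
      = (fun g => ρ g v) '' Set.range (reduction p N F) := by
    rw [← Set.range_comp]
    rfl
  rw [h]
  exact (finite_range_reduction N F).image _

end

/-! ### Passage from `A` through `S` to `B`. -/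

theorem lemma3p9 (p N : ℕ) [Fact p.Prime] (hp : 3 < p) [NeZero N]
    (F : Type*) [Field F] [CharP F p]
    (A B : Type) [AddCommGroup A] [Module (AlgebraicClosure (ZMod p)) A]
    [AddCommGroup B] [Module (AlgebraicClosure (ZMod p)) B]
    (ρA : Representation (AlgebraicClosure (ZMod p)) (GL (Fin 2) F) A)
    (ρB : Representation (AlgebraicClosure (ZMod p)) (GL (Fin 2) F) B)
    (hAB : IsSubquotient ρA ρB)
    (a : heckeSemigroup p N → AlgebraicClosure (ZMod p))
    (α : HeckeH1.H1 (Gamma0Q N) (heckeModule N ρA))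
    (hα : HeckeH1.IsEigenclass (Gamma0Q N) (heckeModule N ρA) a α)
    (hα' : ¬ IsTwistOfPunctual N ρA α) :
    ∃ β : HeckeH1.H1 (Gamma0Q N) (heckeModule N ρB),
      HeckeH1.IsEigenclass (Gamma0Q N) (heckeModule N ρB) a β := by
  obtain ⟨S, T, -, ⟨e⟩⟩ := hAB
  let φ : S.toSubmodule →ₗ[AlgebraicClosure (ZMod p)] A :=
    e.toLinearEquiv.toLinearMap ∘ₗ (T.toSubmodule.comap S.toSubmodule.subtype).mkQ
  have hφ : Function.Surjective φ := e.toLinearEquiv.surjective.comp (Submodule.mkQ_surjective _)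
  have hφρ : ∀ (s : heckeSemigroup p N) (x : S.toSubmodule),
      φ (heckeModule N S.toRepresentation s x) = heckeModule N ρA s (φ x) := fun s x =>
    LinearMap.congr_fun (e.isIntertwining' (reduction p N F s)) (Submodule.Quotient.mk x)
  obtain ⟨c, hc⟩ := HeckeH1.mapH1_surjective hp φ hφρ hφ α
  obtain ⟨W, hW, hcW, hWs⟩ := HeckeH1.exists_finiteDimensional_stable
    (finite_range_heckeModule N S.toRepresentation) c
  obtain ⟨w, hw0, hw⟩ := exists_eigenvector_of_map
    (fun s => HeckeH1.heckeOp (Gamma0Q N) (heckeModule N S.toRepresentation) s)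
    (fun s => HeckeH1.heckeOp (Gamma0Q N) (heckeModule N ρA) s)
    (HeckeH1.heckeOp_comm (isDoubleCosetInvolution_transposeConj p))
    (HeckeH1.mapH1 (Gamma0Q N) φ hφρ) (HeckeH1.mapH1_heckeOp (Gamma0Q N) φ hφρ) a W hWs c hcW
    (by rw [hc]; exact hα.1) (by rw [hc]; exact hα.2)
  have hi : ∀ (g : GL (Fin 2) F) (x : S.toSubmodule),
      S.toSubmodule.subtype (S.toRepresentation g x) = ρB g (S.toSubmodule.subtype x) :=
    fun _ _ => rfl
  refine ⟨HeckeH1.mapH1 (Gamma0Q N) (σ := heckeModule N ρB) S.toSubmodule.subtype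
    (fun s => hi (reduction p N F s)) w, fun h0 => hα' ?_, fun s => ?_⟩
  -- If `w` died in `H¹(B)`, its eigenvalues, which are those of `α`, would be of twisted punctual
  -- form.
  · obtain ⟨j, hj⟩ := exists_eq_detChar_pow_mul_degree hi S.toSubmodule.injective_subtype
      ⟨hw0, hw⟩ h0
    refine ⟨j, ?_⟩
    simp only [zpow_natCast]
    rw [← hj]
    exact hα
  · rw [← HeckeH1.mapH1_heckeOp, hw, map_smul]
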